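/- For $x>1$ let $\operatorname{li}(x)=\mathrm{p.v.}\int_0^x \frac{dt}{\log t}$; it maps $(1,\infty)$ increasingly onto $\mathbb R$, and $\operatorname{ali}=\operatorname{li}^{-1}\colon\mathbb R\to(1,\infty)$ denotes its inverse. Let $V=1+\sum_{n\ge1}P_{n-1}(y)x^{-n}$ be the unique formal series in $1/x$, with polynomials $P_{n-1}$ of degree at most $n$, that satisfies $$V=1+\frac yx-\frac1xV-V_x-\frac1xV_y+\frac1x\log V ,$$ and for $N\ge1$ put, for $u=e^x$, $$f_N(e^x)=x e^x\Bigl(1+\sum_{n=1}^N\frac{P_{n-1}(\log x)}{x^n}\Bigr).$$ Define $(a_n)_{n\ge1}$ by the formal identity $\log\bigl(1-\sum_{n\ge1}n!\,x^{-n}\bigr)^{-1}=\sum_{n\ge1}\frac{a_n}{n}x^{-n}$. Let $c_N$ be the least $c>0$ such that $x\bigl(1-\sum_{n=1}^N n!\,x^{-n}\bigr)\ge1$ for all real $x\ge c$. Let $d_N$ be the least $d>0$ such that $$\Bigl|\log\Bigl(1-\sum_{n=1}^N\frac{n!}{x^n}\Bigr)^{-1}-\sum_{n=1}^N\frac{a_n}{n}\frac1{x^n}\Bigr|\le\frac{a_{N+1}}{N+1}\frac1{|x|^{N+1}}$$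 for all complex $x$ with $|x|\ge d$. Let $\beta_N\ge e$ be the solution of $\beta_N/\log\beta_N=\max(e,c_N,d_N)$, and put $x_N=\max\bigl(\beta_N,\tfrac43(N+1),e^2\bigr)$ and $u_N=e^{x_N}$. Theorem. Let $N\ge1$ be an integer. Call a real number $v\ge u_N$ admissible if $$\Bigl|\operatorname{li}(f_N(u))-u\Bigr|\le 13\,(N+1)!\,\frac{u(\log\log u)^N}{(\log u)^{N+1}}\qquad\text{for all }u>v .$$ There is an admissible $v>u_N$. Moreover, if $v_N$ denotes the least admissible number (so that the following holds a fortiori for $u\ge v$, for every admissible $v$), then for every $u\ge v_N$ there is a real $\theta$ with $|\theta|\le1$ such that $$\operatorname{ali}(u)=f_N(u)+26\,\theta\,(N+1)!\,u\Bigl(\frac{\log\log u}{\log u}\Bigr)^N .$$ -/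

import Mathlib

open Filter Topology MeasureTheory
open scoped Nat Polynomial PowerSeries

noncomputable section

namespace AliExpansion

/-! ### The logarithmic integral and its inverse -/

/-- The truncated integral over `(0, 1 - ε) ∪ (1 + ε, x)` of `1 / log t`. -/
def liTrunc (x ε : ℝ) : ℝ :=
  (∫ t in (0 : ℝ)..(1 - ε), 1 / Real.log t) + ∫ t in (1 + ε)..x, 1 / Real.log t

/-- The logarithmic integral `li x`, for `x > 1`: the principal value of `∫ t in 0..x, 1 / log t`. -/
def li (x : ℝ) : ℝ := limUnder (𝓝[>] (0 : ℝ)) (liTrunc x)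

/-- The inverse function `ℝ → (1, ∞)` of `li : (1, ∞) → ℝ`. -/
def ali : ℝ → ℝ := Function.invFunOn li (Set.Ioi 1)

/-! ### The formal expansion

Formal series `∑ qₙ(y) / xⁿ` are power series in the variable `X = 1 / x` with coefficients in the
polynomial ring `ℝ[y]`. -/

/-- The derivative with respect to `x = 1 / X`: `∑ qₙ / xⁿ ↦ - ∑ n qₙ / xⁿ⁺¹`. -/
def derivX (V : ℝ[X]⟦X⟧) : ℝ[X]⟦X⟧ := -(PowerSeries.X ^ 2 * PowerSeries.derivative ℝ[X] V)

/-- The derivative with respect to `y`, coefficient by coefficient. -/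
def derivY (V : ℝ[X]⟦X⟧) : ℝ[X]⟦X⟧ :=
  PowerSeries.mk fun n => Polynomial.derivative (PowerSeries.coeff n V)

/-- The operator `T V = 1 + y/x - V/x - V_x - V_y/x + (log V)/x`. -/
def formalT (V : ℝ[X]⟦X⟧) : ℝ[X]⟦X⟧ :=
  1 + PowerSeries.C Polynomial.X * PowerSeries.X - PowerSeries.X * V - derivX V
    - PowerSeries.X * derivY V + PowerSeries.X * PowerSeries.logOf V

/-- `V = ∑ qₙ(y) / xⁿ`, with `q₀ = 1` and `deg qₙ ≤ n`, solves
`V = 1 + y/x - V/x - V_x - V_y/x + (log V)/x`. -/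
def IsFormalSolution (V : ℝ[X]⟦X⟧) : Prop :=
  (∀ n, (PowerSeries.coeff n V).natDegree ≤ n) ∧ PowerSeries.constantCoeff V = 1 ∧ V = formalT V

theorem coeff_logOf_congr {V W : ℝ[X]⟦X⟧} (hV : PowerSeries.constantCoeff V = 1)
    (hW : PowerSeries.constantCoeff W = 1) {n : ℕ} (h : PowerSeries.X ^ n ∣ V - W) :
    PowerSeries.X ^ n ∣ PowerSeries.logOf V - PowerSeries.logOf W := by
  have sV : PowerSeries.HasSubst (V - 1) := .of_constantCoeff_zero' (by simp [hV])
  have sW : PowerSeries.HasSubst (W - 1) := .of_constantCoeff_zero' (by simp [hW])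
  rw [PowerSeries.X_pow_dvd_iff]
  intro e he
  rw [map_sub, sub_eq_zero, PowerSeries.logOf, PowerSeries.logOf, PowerSeries.coeff_subst' sV,
    PowerSeries.coeff_subst' sW]
  refine finsum_congr fun d => ?_
  have h1 : PowerSeries.X ^ n ∣ (V - 1) ^ d - (W - 1) ^ d :=
    dvd_trans (by simpa using h) (sub_dvd_pow_sub_pow (V - 1) (W - 1) d)
  have h2 := PowerSeries.X_pow_dvd_iff.1 h1 e he
  rw [map_sub, sub_eq_zero] at h2
  rw [h2]

theorem formalT_congr {V W : ℝ[X]⟦X⟧} (hV : PowerSeries.constantCoeff V = 1)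
    (hW : PowerSeries.constantCoeff W = 1) {n : ℕ} (h : PowerSeries.X ^ n ∣ V - W) :
    PowerSeries.X ^ (n + 1) ∣ formalT V - formalT W := by
  have hl := coeff_logOf_congr hV hW h
  have hy : PowerSeries.X ^ n ∣ derivY V - derivY W := by
    rw [PowerSeries.X_pow_dvd_iff] at h ⊢
    intro m hm
    have := h m hm
    rw [map_sub, sub_eq_zero] at this
    simp [derivY, this]
  have hx : PowerSeries.X ^ (n + 1) ∣ derivX V - derivX W := by
    rw [PowerSeries.X_pow_dvd_iff] at h ⊢
    intro m hm
    rcases m with _ | m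
    · simp [derivX]
    rcases m with _ | m
    · simp [derivX, PowerSeries.coeff_X_pow_mul']
    have := h (m + 1) (by omega)
    rw [map_sub, sub_eq_zero] at this
    simp [derivX, PowerSeries.coeff_X_pow_mul', PowerSeries.coeff_derivative, this]
  have e : formalT V - formalT W = PowerSeries.X * ((PowerSeries.logOf V - PowerSeries.logOf W)
      - (V - W) - (derivY V - derivY W)) - (derivX V - derivX W) := by
    simp only [formalT]; ring
  rw [e]
  refine dvd_sub ?_ hx
  rw [pow_succ']
  exact mul_dvd_mul_left _ (dvd_sub (dvd_sub hl h) hy)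

theorem constantCoeff_formalT {V : ℝ[X]⟦X⟧} : PowerSeries.constantCoeff (formalT V) = 1 := by
  simp [formalT, derivX]

theorem natDegree_coeff_pow {U : ℝ[X]⟦X⟧} (h : ∀ n, (PowerSeries.coeff n U).natDegree ≤ n)
    (d n : ℕ) : (PowerSeries.coeff n (U ^ d)).natDegree ≤ n := by
  induction d generalizing n with
  | zero => by_cases hn : n = 0 <;> simp [PowerSeries.coeff_one, hn]
  | succ d ih =>
    rw [pow_succ, PowerSeries.coeff_mul]
    refine Polynomial.natDegree_sum_le_of_forall_le _ _ fun p hp => ?_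
    have := Finset.HasAntidiagonal.mem_antidiagonal.1 hp
    exact (Polynomial.natDegree_mul_le).trans (by have := ih p.1; have := h p.2; omega)

theorem natDegree_coeff_logOf {V : ℝ[X]⟦X⟧} (h : ∀ n, (PowerSeries.coeff n V).natDegree ≤ n)
    (h1 : PowerSeries.constantCoeff V = 1) (n : ℕ) :
    (PowerSeries.coeff n (PowerSeries.logOf V)).natDegree ≤ n := by
  have sV : PowerSeries.HasSubst (V - 1) := .of_constantCoeff_zero' (by simp [h1])
  have hU : ∀ n, (PowerSeries.coeff n (V - 1)).natDegree ≤ n := by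
    intro n
    rw [map_sub]
    refine (Polynomial.natDegree_sub_le _ _).trans (max_le (h n) ?_)
    by_cases hn : n = 0 <;> simp [PowerSeries.coeff_one, hn]
  rw [PowerSeries.logOf, PowerSeries.coeff_subst' sV]
  refine finsum_induction (fun p : ℝ[X] => p.natDegree ≤ n) (by simp)
    (fun p q hp hq => (Polynomial.natDegree_add_le _ _).trans (max_le hp hq)) fun d => ?_
  have hq := natDegree_coeff_pow hU d n
  rw [PowerSeries.coeff_log]
  split_ifs
  · simp
  · rw [smul_eq_mul, ← Algebra.smul_def]
    exact (Polynomial.natDegree_smul_le _ _).trans hq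

theorem natDegree_coeff_formalT {V : ℝ[X]⟦X⟧} (h : ∀ n, (PowerSeries.coeff n V).natDegree ≤ n)
    (h1 : PowerSeries.constantCoeff V = 1) (n : ℕ) :
    (PowerSeries.coeff n (formalT V)).natDegree ≤ n := by
  rcases n with _ | n
  · rw [PowerSeries.coeff_zero_eq_constantCoeff_apply, constantCoeff_formalT]; simp
  have hx : (PowerSeries.coeff (n + 1) (derivX V)).natDegree ≤ n + 1 := by
    rcases n with _ | n
    · simp [derivX, PowerSeries.coeff_X_pow_mul']
    · have : PowerSeries.coeff (n + 1 + 1) (derivX V)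
          = -(PowerSeries.coeff (n + 1) V * (((n : ℕ) + 1 : ℕ) : ℝ[X])) := by
        simp [derivX, PowerSeries.coeff_X_pow_mul', PowerSeries.coeff_derivative]
      rw [this, Polynomial.natDegree_neg]
      refine Polynomial.natDegree_mul_le.trans ?_
      rw [Polynomial.natDegree_natCast]
      have := h (n + 1)
      omega
  have hc : (PowerSeries.coeff (n + 1)
      (PowerSeries.C (Polynomial.X : ℝ[X]) * PowerSeries.X)).natDegree ≤ n + 1 := by
    rw [PowerSeries.coeff_C_mul, PowerSeries.coeff_X]
    split_ifs <;> simp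
  have hy : (PowerSeries.coeff n (derivY V)).natDegree ≤ n + 1 := by
    rw [derivY, PowerSeries.coeff_mk]
    exact (Polynomial.natDegree_derivative_le _).trans (by have := h n; omega)
  have hl := natDegree_coeff_logOf h h1 n
  have hv := h n
  simp only [formalT, map_add, map_sub, PowerSeries.coeff_succ_X_mul]
  refine (Polynomial.natDegree_add_le _ _).trans (max_le ?_ (by omega))
  refine (Polynomial.natDegree_sub_le _ _).trans (max_le ?_ hy)
  refine (Polynomial.natDegree_sub_le _ _).trans (max_le ?_ hx)
  refine (Polynomial.natDegree_sub_le _ _).trans (max_le ?_ (by omega))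
  refine (Polynomial.natDegree_add_le _ _).trans (max_le ?_ hc)
  simp [PowerSeries.coeff_one]

theorem existsUnique_formalSolution : ∃! V : ℝ[X]⟦X⟧, IsFormalSolution V := by
  have hc : ∀ k, PowerSeries.constantCoeff (formalT^[k] 1) = 1 := by
    intro k
    cases k with
    | zero => simp
    | succ k => rw [Function.iterate_succ_apply']; exact constantCoeff_formalT
  have hd : ∀ k n, (PowerSeries.coeff n (formalT^[k] 1)).natDegree ≤ n := by
    intro k
    induction k with
    | zero => intro n; by_cases hn : n = 0 <;> simp [PowerSeries.coeff_one, hn]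
    | succ k ih =>
      rw [Function.iterate_succ_apply']
      exact natDegree_coeff_formalT ih (hc k)
  have hstep : ∀ k, PowerSeries.X ^ k ∣ formalT^[k + 1] 1 - formalT^[k] 1 := by
    intro k
    induction k with
    | zero => simp
    | succ k ih =>
      have := formalT_congr (hc (k + 1)) (hc k) ih
      rwa [← Function.iterate_succ_apply' formalT, ← Function.iterate_succ_apply' formalT] at this
  have hmono : ∀ k j, PowerSeries.X ^ k ∣ formalT^[k + j] 1 - formalT^[k] 1 := by
    intro k j
    induction j with
    | zero => simp
    | succ j ih =>
      have h1 := (pow_dvd_pow (PowerSeries.X : ℝ[X]⟦X⟧) (Nat.le_add_right k j)).trans (hstep (k + j))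
      have := dvd_add h1 ih
      rwa [sub_add_sub_cancel] at this
  let V : ℝ[X]⟦X⟧ := PowerSeries.mk fun n => PowerSeries.coeff n (formalT^[n + 1] 1)
  have hV : ∀ k, PowerSeries.X ^ k ∣ V - formalT^[k] 1 := by
    intro k
    rw [PowerSeries.X_pow_dvd_iff]
    intro m hm
    obtain ⟨j, rfl⟩ := Nat.exists_eq_add_of_le (Nat.succ_le_of_lt hm)
    have := PowerSeries.X_pow_dvd_iff.1 (hmono (m + 1) j) m (Nat.lt_succ_self m)
    rw [map_sub, sub_eq_zero] at this ⊢
    rw [PowerSeries.coeff_mk, Nat.succ_eq_add_one, this]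
  have hVc : PowerSeries.constantCoeff V = 1 := by
    rw [← PowerSeries.coeff_zero_eq_constantCoeff_apply, PowerSeries.coeff_mk,
      PowerSeries.coeff_zero_eq_constantCoeff_apply]
    exact hc _
  have hzero : ∀ U : ℝ[X]⟦X⟧, (∀ k, PowerSeries.X ^ k ∣ U) → U = 0 := by
    intro U hU
    ext1 n
    simpa using PowerSeries.X_pow_dvd_iff.1 (hU (n + 1)) n (Nat.lt_succ_self n)
  refine ⟨V, ⟨fun n => ?_, hVc, ?_⟩, ?_⟩
  · rw [PowerSeries.coeff_mk]
    exact hd _ _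
  · rw [← sub_eq_zero]
    refine hzero _ fun k => ?_
    have h1 := formalT_congr hVc (hc k) (hV k)
    rw [← Function.iterate_succ_apply' formalT] at h1
    have h2 := dvd_sub (hV (k + 1)) h1
    rw [sub_sub_sub_cancel_right] at h2
    exact (pow_dvd_pow _ (Nat.le_succ k)).trans h2
  · rintro W ⟨-, hWc, hW⟩
    have hVT : V = formalT V := by
      rw [← sub_eq_zero]
      refine hzero _ fun k => ?_
      have h1 := formalT_congr hVc (hc k) (hV k)
      rw [← Function.iterate_succ_apply' formalT] at h1
      have h2 := dvd_sub (hV (k + 1)) h1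
      rw [sub_sub_sub_cancel_right] at h2
      exact (pow_dvd_pow _ (Nat.le_succ k)).trans h2
    rw [← sub_eq_zero]
    refine hzero _ fun k => ?_
    induction k with
    | zero => simp
    | succ k ih =>
      rw [hW, hVT]
      exact formalT_congr hWc hVc ih

/-- The unique solution `V = 1 + ∑ₙ Pₙ₋₁(y) / xⁿ`. -/
def formalV : ℝ[X]⟦X⟧ := existsUnique_formalSolution.choose

theorem formalV_spec : IsFormalSolution formalV := existsUnique_formalSolution.choose_spec.1

/-- The polynomial `Pₙ`, the coefficient of `1 / xⁿ⁺¹` in `V`. -/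
def P (n : ℕ) : ℝ[X] := PowerSeries.coeff (n + 1) formalV

/-- `f_N(u) = x eˣ (1 + ∑_{n=1}^N Pₙ₋₁(log x) / xⁿ)` where `x = log u`. -/
def fN (N : ℕ) (u : ℝ) : ℝ :=
  Real.log u * u *
    (1 + ∑ n ∈ Finset.Icc 1 N, (P (n - 1)).eval (Real.log (Real.log u)) / Real.log u ^ n)

/-! ### The numbers `x_N` and `u_N` -/

/-- The numbers `aₙ` given by `log (1 - ∑ n! / xⁿ)⁻¹ = ∑ (aₙ / n) / xⁿ`, as formal power series in
`1 / x`, both sums being over `n ≥ 1`. -/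
def aSeq (n : ℕ) : ℝ :=
  n * PowerSeries.coeff n
    (PowerSeries.logOf ((1 - PowerSeries.mk fun k => if k = 0 then 0 else (k ! : ℝ))⁻¹))

/-- The least `c > 0` such that `x (1 - ∑_{n=1}^N n! / xⁿ) ≥ 1` for all `x ≥ c`. -/
def cN (N : ℕ) : ℝ :=
  sInf {c : ℝ | 0 < c ∧ ∀ x : ℝ, c ≤ x → 1 ≤ x * (1 - ∑ n ∈ Finset.Icc 1 N, (n ! : ℝ) / x ^ n)}

/-- The least `d > 0` such that for all complex `x` with `|x| ≥ d` the number
`log (1 - ∑_{n=1}^N n! / xⁿ)⁻¹` differs from `∑_{n=1}^N (aₙ / n) / xⁿ` by at most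
`(a_{N+1} / (N+1)) / |x|^{N+1}`. -/
def dN (N : ℕ) : ℝ :=
  sInf {d : ℝ | 0 < d ∧ ∀ x : ℂ, d ≤ ‖x‖ → ∃ θ : ℂ, ‖θ‖ ≤ 1 ∧
    Complex.log (1 - ∑ n ∈ Finset.Icc 1 N, (n ! : ℂ) / x ^ n)⁻¹
      = ∑ n ∈ Finset.Icc 1 N, ((aSeq n : ℂ) / n) * (1 / x ^ n)
        + θ * ((aSeq (N + 1) : ℂ) / (N + 1 : ℕ)) * (1 / x ^ (N + 1))}

/-- `α_N = max(e, c_N, d_N)`. -/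
def alphaN (N : ℕ) : ℝ := max (Real.exp 1) (max (cN N) (dN N))

/-- The solution `β_N ≥ e` of `x / log x = α_N`; it is unique. -/
def betaN (N : ℕ) : ℝ := sInf {x : ℝ | Real.exp 1 ≤ x ∧ x / Real.log x = alphaN N}

/-- `x_N = max(β_N, 4(N+1)/3, e²)`. -/
def xN (N : ℕ) : ℝ := max (betaN N) (max (4 * (N + 1 : ℝ) / 3) (Real.exp 2))

/-- `u_N = exp(x_N)`. -/
def uN (N : ℕ) : ℝ := Real.exp (xN N)

/-- `v ≥ u_N` is admissible if, for all `u > v`,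
`li(f_N(u)) - u = 13 θ (N+1)! u (log log u)^N / (log u)^{N+1}` with some `|θ| ≤ 1`. -/
def IsThreshold (N : ℕ) (v : ℝ) : Prop :=
  uN N ≤ v ∧ ∀ u : ℝ, v < u → ∃ θ : ℝ, |θ| ≤ 1 ∧
    li (fN N u) - u
      = θ * 13 * ((N + 1)! : ℝ) * (u * Real.log (Real.log u) ^ N / Real.log u ^ (N + 1))

/-- The number `v_N`, taken as the least admissible one: a bound for all `u ≥ v_N` then holds for
all `u ≥ v`, whichever admissible `v` is chosen. -/
def vN (N : ℕ) : ℝ := sInf {v : ℝ | IsThreshold N v}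

end AliExpansion

end

/-! Write `x = log u`, `y = log x`, `t = 1/x`, and let `V_N`, `L_N` be the truncations at `t ^ N` of
`V` and `log V`, so that `f_N(e^x) = x e^x V_N(y, t)`. The formal equation is what makes `li
(f_N(e^x))` formally equal to `e^x`. Truncating it gives the exact identity `d/dx f_N(e^x) = e^x (x
+ y + L_N - v_{N+1}(y) t^N)` (`hasDerivAt_fN_exp`), whereas `log f_N(e^x) = x + y + log V_N`. Hence
`F(x) = li (f_N(e^x)) - e^x` has derivative `-e^x ((log V_N - L_N) + v_{N+1}(y) t^N) / log
f_N(e^x)`.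

Two facts bound this by twice `errTerm N x = e^x y^N / x^(N+1)` for large `x`: `log V_N - L_N = O((y
t)^(N+1))` (`exists_abs_log_evalAt_sub_le`), and for `N ≥ 1` the polynomial `v_{N+1}` has degree at
most `N` with `y^N`-coefficient at most `1` in absolute value (`abs_coeff_vCoeff_le`). Since
`errTerm` eventually grows at least at half its own size, integration gives `|F| ≤ 13 errTerm`, so
admissible numbers exist.

Conversely, beyond an admissible number the error in `li (f_N(u))` is at most `10 u`
(`errTerm_bound`). This keeps `f_N(u)` above `1` and, like `ali u`, at most `u ^ 2`. On that range
`li' = 1 / log ≥ 1 / (2 log u)`, so the mean value theorem costs a factor `2 log u` and turns `13`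
into `26`. Continuity adds the endpoint `v_N`. -/

noncomputable section

namespace AliExpansion

/-! ### Properties of the logarithmic integral -/

/-- The function `1 / log t` with its pole at `t = 1` removed. -/
def regLog (t : ℝ) : ℝ := 1 / Real.log t - 1 / (t - 1)

/-- This bound and the next are `1 - 1/t ≤ log t ≤ t - 1` inverted on each side of `1`. Division by
zero gives `regLog 0 = 1` and `regLog 1 = 0`, which respect both bounds. -/
theorem regLog_nonneg {t : ℝ} (ht : 0 ≤ t) : 0 ≤ regLog t := by
  unfold regLog
  rcases ht.eq_or_lt with rfl | ht
  · simp
  have h := Real.log_le_sub_one_of_pos ht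
  rcases lt_trichotomy t 1 with h1 | rfl | h1
  · have := one_div_le_one_div_of_neg_of_le (by linarith : t - 1 < 0) h
    linarith
  · simp
  · have := one_div_le_one_div_of_le (Real.log_pos h1) h
    linarith

theorem regLog_le_one {t : ℝ} (ht : 0 ≤ t) : regLog t ≤ 1 := by
  unfold regLog
  rcases ht.eq_or_lt with rfl | ht
  · simp
  have h := Real.one_sub_inv_le_log_of_pos ht
  have e : 1 - t⁻¹ = (t - 1) / t := by field_simp
  rw [e] at h
  rcases lt_trichotomy t 1 with h1 | rfl | h1
  · have h2 := one_div_le_one_div_of_neg_of_le (Real.log_neg ht h1) h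
    have e2 : 1 / ((t - 1) / t) = 1 + 1 / (t - 1) := by
      have : t - 1 ≠ 0 := by linarith
      field_simp; ring
    linarith
  · simp
  · have h2 := one_div_le_one_div_of_le (div_pos (by linarith) ht) h
    have e2 : 1 / ((t - 1) / t) = 1 + 1 / (t - 1) := by
      have : t - 1 ≠ 0 := by linarith
      field_simp; ring
    linarith

theorem measurable_regLog : Measurable regLog := by
  unfold regLog
  fun_prop

theorem intervalIntegrable_regLog {a b : ℝ} (ha : 0 ≤ a) (hb : 0 ≤ b) :
    IntervalIntegrable regLog volume a b := by
  rw [intervalIntegrable_iff]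
  refine Measure.integrableOn_of_bounded (M := 1) (by simp)
    measurable_regLog.aestronglyMeasurable ?_
  refine (ae_restrict_iff' measurableSet_uIoc).2 (Eventually.of_forall fun t ht => ?_)
  have h0 : 0 ≤ t := (le_min ha hb).trans ht.1.le
  rw [Real.norm_eq_abs, abs_of_nonneg (regLog_nonneg h0)]
  exact regLog_le_one h0

theorem integral_regLog_nonneg {a b : ℝ} (ha : 0 ≤ a) (hab : a ≤ b) :
    0 ≤ ∫ t in a..b, regLog t :=
  intervalIntegral.integral_nonneg hab fun _ ht => regLog_nonneg (ha.trans ht.1)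

theorem integral_regLog_le {a b : ℝ} (ha : 0 ≤ a) (hab : a ≤ b) :
    ∫ t in a..b, regLog t ≤ b - a := by
  have := intervalIntegral.integral_mono_on hab
    (intervalIntegrable_regLog ha (ha.trans hab)) (_root_.intervalIntegrable_const (c := (1 : ℝ)))
    fun _ ht => regLog_le_one (ha.trans ht.1)
  simpa using this

theorem integral_one_div_log {a b : ℝ} (ha : 0 ≤ a) (hb : 0 ≤ b) (h : (1 : ℝ) ∉ Set.uIcc a b) :
    ∫ t in a..b, 1 / Real.log t
      = (∫ t in a..b, regLog t) + (Real.log (b - 1) - Real.log (a - 1)) := by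
  have hne : ∀ t ∈ Set.uIcc a b, t - 1 ≠ 0 := fun t ht h1 => h (by
    rw [sub_eq_zero] at h1; rwa [h1] at ht)
  have hd : ∀ t ∈ Set.uIcc a b, HasDerivAt (fun s => Real.log (s - 1)) (1 / (t - 1)) t :=
    fun t ht => ((hasDerivAt_id t).sub_const 1).log (hne t ht)
  have hi : IntervalIntegrable (fun t : ℝ => 1 / (t - 1)) volume a b := by
    refine ContinuousOn.intervalIntegrable ?_
    exact continuousOn_const.div (by fun_prop) hne
  rw [← intervalIntegral.integral_eq_sub_of_hasDerivAt hd hi,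
    ← intervalIntegral.integral_add (intervalIntegrable_regLog ha hb) hi]
  simp [regLog]

/-- The two pole contributions `log |-ε|` and `-log ε` cancel; what is left out is the integral of
`regLog` over `(1 - ε, 1 + ε)`, which lies in `[0, 2ε]`. -/
theorem tendsto_liTrunc {x : ℝ} (hx : 1 < x) :
    Tendsto (liTrunc x) (𝓝[>] (0 : ℝ)) (𝓝 (Real.log (x - 1) + ∫ t in (0 : ℝ)..x, regLog t)) := by
  have hev : ∀ᶠ ε in 𝓝[>] (0 : ℝ), 0 < ε ∧ ε < min 1 (x - 1) :=
    Ioo_mem_nhdsGT (lt_min one_pos (by linarith))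
  have hb : Tendsto (fun ε : ℝ => 2 * ε) (𝓝[>] (0 : ℝ)) (𝓝 0) := by
    have : Tendsto (fun ε : ℝ => 2 * ε) (𝓝 0) (𝓝 (2 * 0)) := by
      exact (continuous_const.mul continuous_id).tendsto 0
    rw [mul_zero] at this
    exact this.mono_left nhdsWithin_le_nhds
  rw [tendsto_iff_norm_sub_tendsto_zero]
  refine squeeze_zero' (Eventually.of_forall fun _ => norm_nonneg _) ?_ hb
  filter_upwards [hev] with ε ⟨h0, h1⟩
  have h2 : ε < 1 := h1.trans_le (min_le_left _ _)
  have h3 : ε < x - 1 := h1.trans_le (min_le_right _ _)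
  have e1 := integral_one_div_log (a := 0) (b := 1 - ε) le_rfl (by linarith)
    (by rw [Set.uIcc_of_le (by linarith)]; intro h; linarith [h.2])
  have e2 := integral_one_div_log (a := 1 + ε) (b := x) (by linarith) (by linarith)
    (by rw [Set.uIcc_of_le (by linarith)]; intro h; linarith [h.1])
  have e3 := intervalIntegral.integral_add_adjacent_intervals
    (intervalIntegrable_regLog (a := 0) (b := 1 - ε) le_rfl (by linarith))
    (intervalIntegrable_regLog (b := 1 + ε) (by linarith) (by linarith))
  have e4 := intervalIntegral.integral_add_adjacent_intervals
    (intervalIntegrable_regLog (a := 0) (b := 1 + ε) le_rfl (by linarith))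
    (intervalIntegrable_regLog (b := x) (by linarith) (by linarith))
  have e5 := integral_regLog_nonneg (a := 1 - ε) (b := 1 + ε) (by linarith) (by linarith)
  have e6 := integral_regLog_le (a := 1 - ε) (b := 1 + ε) (by linarith) (by linarith)
  have e7 : Real.log (1 - ε - 1) = Real.log ε := by
    rw [← Real.log_neg_eq_log ε]; congr 1; ring
  have e8 : Real.log (1 + ε - 1) = Real.log ε := by congr 1; ring
  rw [liTrunc, e1, e2, e7, e8, Real.norm_eq_abs, abs_le]
  simp only [zero_sub, Real.log_neg_eq_log, Real.log_one]
  constructor <;> linarith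

theorem li_eq {x : ℝ} (hx : 1 < x) :
    li x = Real.log (x - 1) + ∫ t in (0 : ℝ)..x, regLog t :=
  (tendsto_liTrunc hx).limUnder_eq

theorem hasDerivAt_li {x : ℝ} (hx : 1 < x) : HasDerivAt li (1 / Real.log x) x := by
  have hc : ContinuousAt regLog x := by
    have h1 : Real.log x ≠ 0 := (Real.log_pos hx).ne'
    have h2 : x - 1 ≠ 0 := by linarith
    have h3 : x ≠ 0 := by linarith
    unfold regLog
    fun_prop (disch := assumption)
  have h1 := intervalIntegral.integral_hasDerivAt_right
    (intervalIntegrable_regLog le_rfl (by linarith : 0 ≤ x))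
    measurable_regLog.stronglyMeasurable.stronglyMeasurableAtFilter hc
  have h2 : HasDerivAt (fun s => Real.log (s - 1)) (1 / (x - 1)) x :=
    ((hasDerivAt_id x).sub_const 1).log (by simp; linarith)
  have h3 := h2.add h1
  rw [show 1 / (x - 1) + regLog x = 1 / Real.log x by simp [regLog]] at h3
  refine h3.congr_of_eventuallyEq ?_
  filter_upwards [lt_mem_nhds hx] with y hy
  exact li_eq hy

theorem continuousOn_li : ContinuousOn li (Set.Ioi 1) := fun _ hx =>
  (hasDerivAt_li hx).continuousAt.continuousWithinAt

theorem strictMonoOn_li : StrictMonoOn li (Set.Ioi 1) := by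
  refine strictMonoOn_of_deriv_pos (convex_Ioi 1) continuousOn_li fun x hx => ?_
  rw [interior_Ioi] at hx
  rw [(hasDerivAt_li hx).deriv]
  exact one_div_pos.2 (Real.log_pos hx)

theorem li_sub_eq {a b : ℝ} (ha : 1 < a) (hab : a < b) :
    ∃ ξ ∈ Set.Ioo a b, b - a = Real.log ξ * (li b - li a) := by
  obtain ⟨ξ, hξ, h⟩ := exists_hasDerivAt_eq_slope li (fun x => 1 / Real.log x) hab
    (continuousOn_li.mono fun x hx => ha.trans_le hx.1) fun x hx => hasDerivAt_li (ha.trans hx.1)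
  refine ⟨ξ, hξ, ?_⟩
  have h1 : 0 < Real.log ξ := Real.log_pos (ha.trans hξ.1)
  have h2 : 0 < b - a := by linarith
  field_simp at h
  linarith

theorem le_li {x : ℝ} (hx : 1 < x) : Real.log (x - 1) ≤ li x := by
  rw [li_eq hx]
  linarith [integral_regLog_nonneg le_rfl (by linarith : 0 ≤ x)]

theorem li_le {x : ℝ} (hx : 1 < x) : li x ≤ Real.log (x - 1) + x := by
  rw [li_eq hx]
  linarith [integral_regLog_le le_rfl (by linarith : 0 ≤ x)]

theorem surjOn_li : Set.SurjOn li (Set.Ioi 1) Set.univ := by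
  intro u _
  -- The bounds `log (x - 1) ≤ li x ≤ log (x - 1) + x` at these two points place `u` between the
  -- values of `li`.
  have h1 : 1 < 1 + Real.exp (u - 2 - |u|) := by linarith [Real.exp_pos (u - 2 - |u|)]
  have h2 : 1 < 1 + Real.exp u := by linarith [Real.exp_pos u]
  have h3 : Real.exp (u - 2 - |u|) ≤ 1 := Real.exp_le_one_iff.2 (by linarith [le_abs_self u])
  have l1 := li_le h1
  have l2 := le_li h2
  rw [add_sub_cancel_left, Real.log_exp] at l1 l2
  have hle : 1 + Real.exp (u - 2 - |u|) ≤ 1 + Real.exp u := by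
    gcongr; linarith [abs_nonneg u]
  have := intermediate_value_Icc hle
    (continuousOn_li.mono fun x hx => h1.trans_le hx.1)
  obtain ⟨x, hx, hxu⟩ := this (show u ∈ _ from ⟨by linarith [abs_nonneg u], l2⟩)
  exact ⟨x, h1.trans_le hx.1, hxu⟩

theorem one_lt_ali (u : ℝ) : 1 < ali u :=
  Function.invFunOn_mem (surjOn_li (Set.mem_univ u))

theorem li_ali (u : ℝ) : li (ali u) = u :=
  Function.invFunOn_eq (surjOn_li (Set.mem_univ u))

theorem strictMono_ali : StrictMono ali := by
  intro a b hab
  by_contra! h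
  have := strictMonoOn_li.monotoneOn (one_lt_ali b) (one_lt_ali a) h
  rw [li_ali, li_ali] at this
  linarith

theorem continuous_ali : Continuous ali := by
  rw [continuous_iff_continuousAt]
  intro u
  refine continuousAt_of_monotoneOn_of_image_mem_nhds (s := Set.univ)
    (strictMono_ali.monotone.monotoneOn _) univ_mem ?_
  refine mem_of_superset (Ioi_mem_nhds (one_lt_ali u)) fun x hx => ⟨li x, trivial, ?_⟩
  exact strictMonoOn_li.injOn (one_lt_ali _) hx (li_ali _)

theorem exp_bound {x : ℝ} (hx : 7 ≤ x) : 24 * x ≤ Real.exp x := by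
  have h1 : Real.exp x = Real.exp 1 ^ 7 * Real.exp (x - 7) := by
    rw [← Real.exp_nat_mul, ← Real.exp_add]; congr 1; push_cast; ring
  have h2 : (2.7 : ℝ) ^ 7 ≤ Real.exp 1 ^ 7 := by
    have := Real.exp_one_gt_d9
    gcongr
    linarith
  have h3 := Real.add_one_le_exp (x - 7)
  rw [h1]
  have h4 : (1000 : ℝ) ≤ Real.exp 1 ^ 7 := le_trans (by norm_num) h2
  nlinarith

/-- The factor `11` matches `li (f_N(u)) ≤ u + 10 u`, so monotonicity of `li` will give `f_N(u) ≤ u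
^ 2`. -/
theorem lt_li_sq {x : ℝ} (hx : 7 ≤ x) : 11 * Real.exp x < li (Real.exp x ^ 2) := by
  have hb := exp_bound hx
  have h2 : (2 : ℝ) < Real.exp x ^ 2 := by nlinarith
  obtain ⟨ξ, hξ, h⟩ := li_sub_eq (by norm_num : (1 : ℝ) < 2) h2
  have h3 : 0 ≤ li 2 := by
    have := le_li (by norm_num : (1 : ℝ) < 2)
    norm_num at this; exact this
  have h4 : Real.log ξ ≤ 2 * x := by
    have := Real.log_le_log (by linarith [hξ.1]) hξ.2.le
    rwa [Real.log_pow, Real.log_exp] at this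
  have h5 : 0 < Real.log ξ := Real.log_pos (by linarith [hξ.1])
  by_contra! hcon
  have h6 : Real.log ξ * (li (Real.exp x ^ 2) - li 2) ≤ 2 * x * (11 * Real.exp x) := by
    have : li (Real.exp x ^ 2) - li 2 ≤ 11 * Real.exp x := by linarith
    refine (mul_le_mul_of_nonneg_left this h5.le).trans ?_
    gcongr
  nlinarith [Real.exp_pos x]

/-! ### The coefficients of the formal solution -/

/-- The coefficient of `1 / xⁿ` in `V`. -/
def vCoeff (n : ℕ) : ℝ[X] := PowerSeries.coeff n formalV

/-- The coefficient of `1 / xⁿ` in `log V`. -/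
def logCoeff (n : ℕ) : ℝ[X] := PowerSeries.coeff n (PowerSeries.logOf formalV)

/-- Chain rule, after substituting `f - 1` for `X` in `(log (1 + X))' (1 + X) = 1`. -/
theorem derivative_logOf {A : Type*} [CommRing A] [Algebra ℚ A] {f : A⟦X⟧}
    (hf : PowerSeries.constantCoeff f = 1) :
    PowerSeries.derivative A (PowerSeries.logOf f) * f = PowerSeries.derivative A f := by
  have hs : PowerSeries.HasSubst (f - 1) := .of_constantCoeff_zero' (by simp [hf])
  have hg : PowerSeries.derivative A (PowerSeries.log A) * (1 + PowerSeries.X) = 1 := by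
    rw [PowerSeries.deriv_log]
    ext n
    rcases n with _ | n
    · simp
    · simp [mul_add, PowerSeries.coeff_succ_mul_X, pow_succ, PowerSeries.coeff_one]
  have h1 := congrArg (PowerSeries.subst (f - 1)) hg
  rw [PowerSeries.subst_mul hs, PowerSeries.subst_add hs, PowerSeries.subst_X hs] at h1
  have h2 : PowerSeries.subst (f - 1) (1 : A⟦X⟧) = 1 := by
    rw [← PowerSeries.coe_substAlgHom hs, map_one]
  rw [h2, add_sub_cancel] at h1
  rw [PowerSeries.logOf, PowerSeries.derivative_subst hs, mul_right_comm, h1, one_mul]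
  simp

theorem natDegree_vCoeff_le (n : ℕ) : (vCoeff n).natDegree ≤ n := formalV_spec.1 n

theorem natDegree_logCoeff_le (n : ℕ) : (logCoeff n).natDegree ≤ n :=
  natDegree_coeff_logOf formalV_spec.1 formalV_spec.2.1 n

@[simp] theorem vCoeff_zero : vCoeff 0 = 1 := by
  rw [vCoeff, PowerSeries.coeff_zero_eq_constantCoeff_apply, formalV_spec.2.1]

@[simp] theorem logCoeff_zero : logCoeff 0 = 0 := by
  rw [logCoeff, PowerSeries.coeff_zero_eq_constantCoeff_apply,
    PowerSeries.constantCoeff_logOf formalV_spec.2.1]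

theorem vCoeff_succ (n : ℕ) :
    vCoeff (n + 1) = (if n = 0 then Polynomial.X else 0) - vCoeff n + (n : ℝ[X]) * vCoeff n
      - Polynomial.derivative (vCoeff n) + logCoeff n := by
  have h := congrArg (PowerSeries.coeff (n + 1)) formalV_spec.2.2
  have hx : PowerSeries.coeff (n + 1) (derivX formalV) = -((n : ℝ[X]) * vCoeff n) := by
    rcases n with _ | n
    · simp [derivX, PowerSeries.coeff_X_pow_mul']
    · simp [derivX, PowerSeries.coeff_X_pow_mul', PowerSeries.coeff_derivative, vCoeff, mul_comm]
  simp only [formalT, map_add, map_sub, PowerSeries.coeff_succ_X_mul, hx, derivY,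
    PowerSeries.coeff_mk, PowerSeries.coeff_C_mul, PowerSeries.coeff_X] at h
  simp only [vCoeff, logCoeff]
  rw [h]
  by_cases hn : n = 0 <;> simp [hn, PowerSeries.coeff_one, vCoeff]

theorem sum_logCoeff_mul_vCoeff (n : ℕ) :
    ∑ k ∈ Finset.range (n + 1), (k + 1 : ℝ[X]) * logCoeff (k + 1) * vCoeff (n - k)
      = (n + 1 : ℝ[X]) * vCoeff (n + 1) := by
  have h := congrArg (PowerSeries.coeff n) (derivative_logOf formalV_spec.2.1)
  rw [PowerSeries.coeff_mul, Finset.Nat.sum_antidiagonal_eq_sum_range_succ_mk] at h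
  simp only [PowerSeries.coeff_derivative] at h
  rw [mul_comm (n + 1 : ℝ[X]), vCoeff, ← h]
  refine Finset.sum_congr rfl fun k _ => ?_
  rw [logCoeff, vCoeff]
  ring

/-- In the recursion `vCoeff_succ` every term but the initial `y` has degree at most `n`. The
top-degree part of `V` is therefore `1 + y t`. -/
theorem coeff_vCoeff_add_one {n : ℕ} :
    (vCoeff (n + 1)).coeff (n + 1) = if n = 0 then 1 else 0 := by
  have h1 : (vCoeff n).coeff (n + 1) = 0 :=
    Polynomial.coeff_eq_zero_of_natDegree_lt (by have := natDegree_vCoeff_le n; omega)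
  have h2 : (vCoeff n).coeff (n + 1 + 1) = 0 :=
    Polynomial.coeff_eq_zero_of_natDegree_lt (by have := natDegree_vCoeff_le n; omega)
  have h3 : (logCoeff n).coeff (n + 1) = 0 :=
    Polynomial.coeff_eq_zero_of_natDegree_lt (by have := natDegree_logCoeff_le n; omega)
  rw [vCoeff_succ]
  by_cases hn : n = 0
  all_goals simp [hn, h1, h2, h3, Polynomial.coeff_derivative, Polynomial.coeff_X]
  all_goals simp_all

theorem natDegree_vCoeff_le_sub_one {n : ℕ} (hn : 1 ≤ n) : (vCoeff (n + 1)).natDegree ≤ n := by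
  rw [Polynomial.natDegree_le_iff_coeff_eq_zero]
  intro m hm
  rcases (Nat.succ_le_of_lt hm).eq_or_lt with rfl | h
  · rw [Nat.succ_eq_add_one, coeff_vCoeff_add_one, if_neg (by omega)]
  · exact Polynomial.coeff_eq_zero_of_natDegree_lt (by have := natDegree_vCoeff_le (n + 1); omega)

theorem coeff_mul_top {p q : ℝ[X]} {m n : ℕ} (hp : p.natDegree ≤ m) (hq : q.natDegree ≤ n) :
    (p * q).coeff (m + n) = p.coeff m * q.coeff n :=
  Polynomial.coeff_mul_add_eq_of_natDegree_le hp hq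

/-- The top-degree part of `log V` is `log (1 + y t)`. Only `v_0` and `v_1` contribute to the top
coefficients of the convolution, leaving a two-term recursion with alternating sign. -/
theorem coeff_logCoeff_top (n : ℕ) : (n + 1 : ℝ) * (logCoeff (n + 1)).coeff (n + 1) = (-1) ^ n := by
  have key : ∀ n : ℕ, ∑ k ∈ Finset.range (n + 1),
      (k + 1 : ℝ) * (logCoeff (k + 1)).coeff (k + 1) * (vCoeff (n - k)).coeff (n - k)
        = (n + 1 : ℝ) * (vCoeff (n + 1)).coeff (n + 1) := by
    intro n
    have h := congrArg (fun p : ℝ[X] => p.coeff (n + 1)) (sum_logCoeff_mul_vCoeff n)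
    simp only [Polynomial.finsetSum_coeff] at h
    have hc : ∀ (k : ℕ) (p : ℝ[X]) (m : ℕ), ((k + 1 : ℝ[X]) * p).coeff m = (k + 1) * p.coeff m := by
      intro k p m
      have : (k + 1 : ℝ[X]) = Polynomial.C (k + 1 : ℝ) := by simp
      rw [this, Polynomial.coeff_C_mul]
    rw [hc] at h
    rw [← h]
    refine Finset.sum_congr rfl fun k hk => ?_
    have hk' := Finset.mem_range.1 hk
    rw [mul_assoc, mul_assoc, hc]
    congr 1
    conv_rhs => rw [show n + 1 = (k + 1) + (n - k) by omega]
    rw [coeff_mul_top (natDegree_logCoeff_le _) (natDegree_vCoeff_le _)]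
  rcases n with _ | n
  · have := key 0
    simpa [coeff_vCoeff_add_one (n := 0)] using this
  · induction n with
    | zero =>
      have h0 := key 0
      have h1 := key 1
      simp [Finset.sum_range_succ, coeff_vCoeff_add_one (n := 0),
        coeff_vCoeff_add_one (n := 1)] at h0 h1 ⊢
      linarith
    | succ n ih =>
      have h := key (n + 1 + 1)
      rw [Finset.sum_range_succ, Finset.sum_range_succ, Finset.sum_eq_zero] at h
      · have e : n + 1 + 1 - (n + 1) = 0 + 1 := by omega
        rw [e, coeff_vCoeff_add_one, coeff_vCoeff_add_one, ih] at h
        simp at h ⊢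
        rw [pow_succ]
        linarith
      · intro k hk
        have := Finset.mem_range.1 hk
        obtain ⟨j, hj⟩ : ∃ j, n + 1 + 1 - k = (j + 1) + 1 := ⟨n - k, by omega⟩
        rw [hj, coeff_vCoeff_add_one]
        simp

/-- The terms `-v_n + n v_n` contribute `n - 1` times the top coefficient of `v_n`, which vanishes
unless `n = 1`; so the coefficient equals that of `log V`, namely `± 1 / n`. -/
theorem abs_coeff_vCoeff_le {n : ℕ} (hn : 1 ≤ n) : |(vCoeff (n + 1)).coeff n| ≤ 1 := by
  obtain ⟨m, rfl⟩ := Nat.exists_eq_add_of_le' hn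
  have hd : (vCoeff (m + 1)).coeff (m + 1 + 1) = 0 :=
    Polynomial.coeff_eq_zero_of_natDegree_lt (by have := natDegree_vCoeff_le (m + 1); omega)
  have hm : ((m + 1 : ℕ) * vCoeff (m + 1)).coeff (m + 1)
      = (m + 1 : ℝ) * (vCoeff (m + 1)).coeff (m + 1) := by
    have : ((m + 1 : ℕ) : ℝ[X]) = Polynomial.C (m + 1 : ℝ) := by simp
    rw [this, Polynomial.coeff_C_mul]
  have h : (vCoeff (m + 1 + 1)).coeff (m + 1) = (logCoeff (m + 1)).coeff (m + 1) := by
    rw [vCoeff_succ, if_neg (by omega), Polynomial.coeff_add, Polynomial.coeff_sub,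
      Polynomial.coeff_add, Polynomial.coeff_sub, Polynomial.coeff_derivative, hd, hm,
      coeff_vCoeff_add_one]
    split_ifs with h0 <;> simp [h0]
  rw [h]
  have h2 := congrArg abs (coeff_logCoeff_top m)
  rw [abs_mul, abs_pow, abs_neg, abs_one, one_pow, abs_of_pos (by positivity)] at h2
  have h3 := abs_nonneg ((logCoeff (m + 1)).coeff (m + 1))
  have h4 : (0 : ℝ) ≤ m := by positivity
  nlinarith

/-! ### Truncations of the formal solution and of its logarithm -/

/-- The value of `p ∈ ℝ[y][t]` at real numbers `y` and `t`. -/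
def evalAt (p : ℝ[X][X]) (y t : ℝ) : ℝ := (p.map (Polynomial.evalRingHom y)).eval t

/-- The sum of the terms `qₙ(y) tⁿ` of `V` with `n ≤ N`. -/
def vPoly (N : ℕ) : ℝ[X][X] := PowerSeries.trunc (N + 1) formalV

/-- The sum of the terms `ℓₙ(y) tⁿ` of `log V` with `n ≤ N`. -/
def logPoly (N : ℕ) : ℝ[X][X] := PowerSeries.trunc (N + 1) (PowerSeries.logOf formalV)

theorem coeff_vPoly (N n : ℕ) : (vPoly N).coeff n = if n < N + 1 then vCoeff n else 0 := by
  rw [vPoly, PowerSeries.coeff_trunc]; rfl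

theorem coeff_logPoly (N n : ℕ) : (logPoly N).coeff n = if n < N + 1 then logCoeff n else 0 := by
  rw [logPoly, PowerSeries.coeff_trunc]; rfl

theorem evalAt_eq_sum {p : ℝ[X][X]} {m : ℕ} (hp : p.natDegree < m) (y t : ℝ) :
    evalAt p y t = ∑ n ∈ Finset.range m, (p.coeff n).eval y * t ^ n := by
  rw [evalAt, Polynomial.eval_eq_sum_range' (Polynomial.natDegree_map_le.trans_lt hp)]
  simp

theorem evalAt_vPoly (N : ℕ) (y t : ℝ) :
    evalAt (vPoly N) y t = ∑ n ∈ Finset.range (N + 1), (vCoeff n).eval y * t ^ n := by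
  rw [evalAt_eq_sum (p := vPoly N) (m := N + 1) (PowerSeries.natDegree_trunc_lt _ _)]
  refine Finset.sum_congr rfl fun n hn => ?_
  rw [coeff_vPoly, if_pos (Finset.mem_range.1 hn)]

theorem evalAt_logPoly (N : ℕ) (y t : ℝ) :
    evalAt (logPoly N) y t = ∑ n ∈ Finset.range (N + 1), (logCoeff n).eval y * t ^ n := by
  rw [evalAt_eq_sum (p := logPoly N) (m := N + 1) (PowerSeries.natDegree_trunc_lt _ _)]
  refine Finset.sum_congr rfl fun n hn => ?_
  rw [coeff_logPoly, if_pos (Finset.mem_range.1 hn)]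

theorem hasDerivAt_evalAt (p : ℝ[X][X]) (y t : ℝ) :
    HasDerivAt (evalAt p y) (evalAt (Polynomial.derivative p) y t) t := by
  have := (p.map (Polynomial.evalRingHom y)).hasDerivAt t
  rwa [Polynomial.derivative_map] at this

theorem exists_abs_eval_le {p : ℝ[X]} {m : ℕ} (hp : p.natDegree ≤ m) :
    ∃ C : ℝ, 0 ≤ C ∧ ∀ y : ℝ, 1 ≤ y → |p.eval y| ≤ C * y ^ m := by
  refine ⟨∑ i ∈ Finset.range (m + 1), |p.coeff i|,
    Finset.sum_nonneg fun _ _ => abs_nonneg _, fun y hy => ?_⟩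
  rw [Polynomial.eval_eq_sum_range' (Nat.lt_succ_of_le hp), Finset.sum_mul]
  refine (Finset.abs_sum_le_sum_abs _ _).trans (Finset.sum_le_sum fun i hi => ?_)
  rw [abs_mul, abs_of_nonneg (by positivity : 0 ≤ y ^ i)]
  gcongr
  exact Nat.lt_succ_iff.1 (Finset.mem_range.1 hi)

/-- The term of order `m + j` is at most a constant times `y^(m+k) t^m (y t)^j`, and `y t ≤ 1`. -/
theorem exists_abs_evalAt_le {p : ℝ[X][X]} {m k : ℕ} (hp : ∀ n, (p.coeff n).natDegree ≤ n + k)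
    (h0 : ∀ n < m, p.coeff n = 0) :
    ∃ C : ℝ, 0 ≤ C ∧ ∀ y t : ℝ, 1 ≤ y → 0 ≤ t → y * t ≤ 1 →
      |evalAt p y t| ≤ C * (y ^ (m + k) * t ^ m) := by
  choose c hc0 hc using fun n => exists_abs_eval_le (hp n)
  refine ⟨∑ n ∈ Finset.range (p.natDegree + 1), c n, Finset.sum_nonneg fun _ _ => hc0 _,
    fun y t hy ht hyt => ?_⟩
  rw [evalAt_eq_sum (Nat.lt_succ_self _), Finset.sum_mul]
  refine (Finset.abs_sum_le_sum_abs _ _).trans (Finset.sum_le_sum fun n _ => ?_)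
  have hn0 := hc0 n
  by_cases hn : n < m
  · rw [h0 n hn]
    simp only [Polynomial.eval_zero, zero_mul, abs_zero]
    positivity
  · obtain ⟨j, rfl⟩ := Nat.exists_eq_add_of_le (not_lt.1 hn)
    rw [abs_mul, abs_of_nonneg (by positivity : 0 ≤ t ^ (m + j))]
    calc |(p.coeff (m + j)).eval y| * t ^ (m + j)
        ≤ (c (m + j) * y ^ (m + j + k)) * t ^ (m + j) := by gcongr; exact hc _ y hy
      _ = c (m + j) * (y ^ (m + k) * t ^ m) * (y * t) ^ j := by ring
      _ ≤ c (m + j) * (y ^ (m + k) * t ^ m) * 1 := by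
        gcongr
        exact pow_le_one₀ (by positivity) hyt
      _ = _ := mul_one _

theorem exists_abs_evalAt_vPoly_sub_one_le (N : ℕ) :
    ∃ C : ℝ, 0 ≤ C ∧ ∀ y t : ℝ, 1 ≤ y → 0 ≤ t → y * t ≤ 1 →
      |evalAt (vPoly N) y t - 1| ≤ C * (y * t) := by
  obtain ⟨C, hC0, hC⟩ := exists_abs_evalAt_le (p := vPoly N - 1) (m := 1) (k := 0) (fun n => by
    rw [Polynomial.coeff_sub, coeff_vPoly, Polynomial.coeff_one]
    refine (Polynomial.natDegree_sub_le _ _).trans (max_le ?_ ?_)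
    · split_ifs
      · exact natDegree_vCoeff_le n
      · simp
    · split_ifs <;> simp) (fun n hn => by
    obtain rfl : n = 0 := by omega
    simp [coeff_vPoly])
  refine ⟨C, hC0, fun y t hy ht hyt => ?_⟩
  have := hC y t hy ht hyt
  simpa [evalAt] using this

/-- The formal identity `V' = V (log V)'` kills all orders below `t ^ N` in the truncated residual.
Differentiating in `t` shifts the order by one, hence `k = 1` in the degree bound. -/
theorem exists_abs_evalAt_residual_le (N : ℕ) :
    ∃ C : ℝ, 0 ≤ C ∧ ∀ y t : ℝ, 1 ≤ y → 0 ≤ t → y * t ≤ 1 →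
      |evalAt (Polynomial.derivative (vPoly N)) y t
        - evalAt (vPoly N) y t * evalAt (Polynomial.derivative (logPoly N)) y t|
        ≤ C * (y ^ (N + 1) * t ^ N) := by
  have hnat : ∀ (p : ℝ[X]) (n : ℕ), (p * ((n : ℝ[X]) + 1)).natDegree ≤ p.natDegree := by
    intro p n
    have : ((n : ℝ[X]) + 1) = Polynomial.C ((n : ℝ) + 1) := by simp
    rw [this]
    exact Polynomial.natDegree_mul_C_le _ _
  have hv : ∀ n, ((vPoly N).coeff n).natDegree ≤ n := by
    intro n
    rw [coeff_vPoly]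
    split_ifs
    · exact natDegree_vCoeff_le n
    · simp
  have hl : ∀ n, ((logPoly N).coeff n).natDegree ≤ n := by
    intro n
    rw [coeff_logPoly]
    split_ifs
    · exact natDegree_logCoeff_le n
    · simp
  obtain ⟨C, hC0, hC⟩ := exists_abs_evalAt_le (m := N) (k := 1)
    (p := Polynomial.derivative (vPoly N) - vPoly N * Polynomial.derivative (logPoly N))
    (fun n => by
      rw [Polynomial.coeff_sub, Polynomial.coeff_derivative, Polynomial.coeff_mul]
      refine (Polynomial.natDegree_sub_le _ _).trans (max_le ((hnat _ _).trans (hv _)) ?_)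
      refine Polynomial.natDegree_sum_le_of_forall_le _ _ fun ij hij => ?_
      have := Finset.HasAntidiagonal.mem_antidiagonal.1 hij
      rw [Polynomial.coeff_derivative]
      refine Polynomial.natDegree_mul_le.trans ?_
      have h1 := (hnat ((logPoly N).coeff (ij.2 + 1)) ij.2).trans (hl _)
      have h2 := hv ij.1
      omega)
    (fun n hn => by
      rw [Polynomial.coeff_sub, Polynomial.coeff_derivative, mul_comm (vPoly N),
        Polynomial.coeff_mul, Finset.Nat.sum_antidiagonal_eq_sum_range_succ_mk, coeff_vPoly,
        if_pos (by omega), mul_comm (vCoeff (n + 1)), ← sum_logCoeff_mul_vCoeff, sub_eq_zero]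
      refine Finset.sum_congr rfl fun k hk => ?_
      have := Finset.mem_range.1 hk
      simp only [Polynomial.coeff_derivative, coeff_vPoly, coeff_logPoly]
      rw [if_pos (by omega), if_pos (by omega)]
      ring)
  refine ⟨C, hC0, fun y t hy ht hyt => ?_⟩
  have := hC y t hy ht hyt
  simpa [evalAt] using this

/-- At fixed `y`, `log V_N - L_N` vanishes at `t = 0` and its `t`-derivative is the residual divided
by `V_N ≥ 1/2`; the mean value inequality supplies the extra factor `t`. -/
theorem exists_abs_log_evalAt_sub_le (N : ℕ) :
    ∃ C δ : ℝ, 0 ≤ C ∧ 0 < δ ∧ ∀ y t : ℝ, 1 ≤ y → 0 ≤ t → y * t ≤ δ →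
      1 / 2 ≤ evalAt (vPoly N) y t ∧
      |Real.log (evalAt (vPoly N) y t) - evalAt (logPoly N) y t| ≤ C * (y * t) ^ (N + 1) := by
  obtain ⟨B, hB0, hB⟩ := exists_abs_evalAt_vPoly_sub_one_le N
  obtain ⟨C, hC0, hC⟩ := exists_abs_evalAt_residual_le N
  have hδ : 0 < 1 / (2 * (B + 1)) := by positivity
  have hδ1 : 1 / (2 * (B + 1)) ≤ 1 := by
    rw [div_le_one (by positivity)]; linarith
  have hlow : ∀ y t : ℝ, 1 ≤ y → 0 ≤ t → y * t ≤ 1 / (2 * (B + 1)) →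
      1 / 2 ≤ evalAt (vPoly N) y t := by
    intro y t hy ht hyt
    have h1 := (abs_le.1 (hB y t hy ht (hyt.trans hδ1))).1
    have h2 : B * (y * t) ≤ (B + 1) * (1 / (2 * (B + 1))) := by gcongr; linarith
    have h3 : (B + 1) * (1 / (2 * (B + 1))) = 1 / 2 := by field_simp
    linarith
  refine ⟨2 * C, 1 / (2 * (B + 1)), by positivity, hδ, fun y t hy ht hyt =>
    ⟨hlow y t hy ht hyt, ?_⟩⟩
  have hst : ∀ s ∈ Set.Icc 0 t, 0 ≤ s ∧ y * s ≤ 1 / (2 * (B + 1)) := fun s hs =>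
    ⟨hs.1, (mul_le_mul_of_nonneg_left hs.2 (by linarith)).trans hyt⟩
  have hder : ∀ s ∈ Set.Icc 0 t, HasDerivWithinAt
      (fun s => Real.log (evalAt (vPoly N) y s) - evalAt (logPoly N) y s)
      (evalAt (Polynomial.derivative (vPoly N)) y s / evalAt (vPoly N) y s
        - evalAt (Polynomial.derivative (logPoly N)) y s) (Set.Icc 0 t) s := by
    intro s hs
    have h1 := hlow y s hy (hst s hs).1 (hst s hs).2
    exact (((hasDerivAt_evalAt _ y s).log (by linarith)).sub
      (hasDerivAt_evalAt _ y s)).hasDerivWithinAt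
  have hbound : ∀ s ∈ Set.Icc 0 t, ‖evalAt (Polynomial.derivative (vPoly N)) y s
      / evalAt (vPoly N) y s - evalAt (Polynomial.derivative (logPoly N)) y s‖
        ≤ 2 * C * (y ^ (N + 1) * t ^ N) := by
    intro s hs
    have h1 := hlow y s hy (hst s hs).1 (hst s hs).2
    have h2 := hC y s hy (hst s hs).1 ((hst s hs).2.trans hδ1)
    have h3 : C * (y ^ (N + 1) * s ^ N) ≤ C * (y ^ (N + 1) * t ^ N) := by
      gcongr
      · exact hs.1
      · exact hs.2
    have h0 : 0 < evalAt (vPoly N) y s := by linarith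
    rw [Real.norm_eq_abs, div_sub' h0.ne', abs_div, abs_of_pos h0, div_le_iff₀ h0]
    have h4 : 0 ≤ C * (y ^ (N + 1) * t ^ N) := by positivity
    nlinarith
  have key := (convex_Icc 0 t).norm_image_sub_le_of_norm_hasDerivWithin_le hder hbound
    (Set.left_mem_Icc.2 ht) (Set.right_mem_Icc.2 ht)
  have z1 : evalAt (vPoly N) y 0 = 1 := by
    rw [evalAt_vPoly, Finset.sum_range_succ']; simp
  have z2 : evalAt (logPoly N) y 0 = 0 := by
    rw [evalAt_logPoly, Finset.sum_range_succ']; simp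
  rw [z1, z2, Real.log_one, sub_zero, sub_zero, sub_zero, Real.norm_eq_abs, Real.norm_eq_abs,
    abs_of_nonneg ht] at key
  refine key.trans (le_of_eq ?_)
  ring

/-! ### The behaviour of `li (f_N u) - u` for large `u` -/

theorem fN_exp (N : ℕ) (x : ℝ) :
    fN N (Real.exp x) = x * Real.exp x * evalAt (vPoly N) (Real.log x) x⁻¹ := by
  rw [fN, Real.log_exp, evalAt_vPoly, Finset.sum_range_succ', Finset.range_eq_Ico,
    Finset.sum_Ico_add' (fun n => (vCoeff n).eval (Real.log x) * x⁻¹ ^ n) 0 N 1, add_comm (1 : ℝ)]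
  congr 2
  · refine Finset.sum_congr (by ext; simp) fun n hn => ?_
    have hn : 1 ≤ n := (Finset.mem_Icc.1 (by simpa using hn)).1
    rw [P, Nat.sub_add_cancel hn, inv_pow, div_eq_mul_inv, vCoeff]
  · simp

theorem hasDerivAt_fN_exp (N : ℕ) {x : ℝ} (hx : 0 < x) :
    HasDerivAt (fun x => fN N (Real.exp x))
      (Real.exp x * (x + Real.log x + evalAt (logPoly N) (Real.log x) x⁻¹
        - (vCoeff (N + 1)).eval (Real.log x) * x⁻¹ ^ N)) x := by
  have hS : HasDerivAt (fun x => evalAt (vPoly N) (Real.log x) x⁻¹)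
      (x⁻¹ * ∑ n ∈ Finset.range (N + 1), ((Polynomial.derivative (vCoeff n)).eval (Real.log x)
        - n * (vCoeff n).eval (Real.log x)) * x⁻¹ ^ n) x := by
    simp only [evalAt_vPoly]
    rw [Finset.mul_sum]
    refine HasDerivAt.fun_sum fun n _ => ?_
    have h1 := ((vCoeff n).hasDerivAt (Real.log x)).comp x (Real.hasDerivAt_log hx.ne')
    have h2 := (hasDerivAt_inv hx.ne').pow n
    refine (h1.mul h2).congr_deriv ?_
    rcases n with _ | n
    · simp
    · simp only [Function.comp, Nat.add_sub_cancel, Pi.pow_apply]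
      push_cast
      ring
  have h := ((hasDerivAt_id x).mul (Real.hasDerivAt_exp x)).mul hS
  have hfun : (fun x => fN N (Real.exp x))
      = fun x => x * Real.exp x * evalAt (vPoly N) (Real.log x) x⁻¹ := funext (fN_exp N)
  rw [hfun]
  refine h.congr_deriv ?_
  -- `e1` stops at `v_N`, while `e2`, the recursion summed over `n ≤ N`, reaches `v_{N+1}`: this
  -- mismatch is the error term in the derivative.
  have e1 : x * evalAt (vPoly N) (Real.log x) x⁻¹
      = x + ∑ n ∈ Finset.range N, (vCoeff (n + 1)).eval (Real.log x) * x⁻¹ ^ n := by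
    rw [evalAt_vPoly, Finset.sum_range_succ', mul_add, Finset.mul_sum, add_comm]
    congr 1
    · simp
    · refine Finset.sum_congr rfl fun n _ => ?_
      rw [pow_succ]
      field_simp
  have e2 : ∑ n ∈ Finset.range (N + 1), (vCoeff (n + 1)).eval (Real.log x) * x⁻¹ ^ n
      = Real.log x - evalAt (vPoly N) (Real.log x) x⁻¹
        - (∑ n ∈ Finset.range (N + 1), ((Polynomial.derivative (vCoeff n)).eval (Real.log x)
        - n * (vCoeff n).eval (Real.log x)) * x⁻¹ ^ n)
        + evalAt (logPoly N) (Real.log x) x⁻¹ := by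
    have e3 : Real.log x = ∑ n ∈ Finset.range (N + 1),
        (if n = 0 then Real.log x else 0) * x⁻¹ ^ n := by
      rw [Finset.sum_range_succ']; simp
    have e4 : ∑ n ∈ Finset.range (N + 1), (vCoeff (n + 1)).eval (Real.log x) * x⁻¹ ^ n
        = ∑ n ∈ Finset.range (N + 1), ((if n = 0 then Real.log x else 0) * x⁻¹ ^ n
          - (vCoeff n).eval (Real.log x) * x⁻¹ ^ n
          - ((Polynomial.derivative (vCoeff n)).eval (Real.log x)
            - n * (vCoeff n).eval (Real.log x)) * x⁻¹ ^ n
          + (logCoeff n).eval (Real.log x) * x⁻¹ ^ n) := by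
      refine Finset.sum_congr rfl fun n _ => ?_
      rw [vCoeff_succ]
      by_cases hn : n = 0
      all_goals simp [hn]
      all_goals ring
    rw [e4, Finset.sum_add_distrib, Finset.sum_sub_distrib, Finset.sum_sub_distrib, ← e3,
      evalAt_vPoly, evalAt_logPoly]
  rw [Finset.sum_range_succ] at e2
  have hxx : x * x⁻¹ = 1 := mul_inv_cancel₀ hx.ne'
  simp only [id, one_mul, Pi.mul_apply]
  linear_combination (Real.exp x) * e1 + Real.exp x * e2
    + Real.exp x * (∑ n ∈ Finset.range (N + 1),
      ((Polynomial.derivative (vCoeff n)).eval (Real.log x)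
        - n * (vCoeff n).eval (Real.log x)) * x⁻¹ ^ n) * hxx

theorem tendsto_log_mul_inv : Tendsto (fun x : ℝ => Real.log x * x⁻¹) atTop (𝓝 0) := by
  have := Real.isLittleO_log_id_atTop.tendsto_div_nhds_zero
  simpa [div_eq_mul_inv] using this

theorem eventually_evalAt_vPoly (N : ℕ) :
    ∀ᶠ x : ℝ in atTop, 1 / 2 ≤ evalAt (vPoly N) (Real.log x) x⁻¹ := by
  obtain ⟨C, δ, -, hδ, h⟩ := exists_abs_log_evalAt_sub_le N
  filter_upwards [eventually_ge_atTop 0, Real.tendsto_log_atTop.eventually_ge_atTop 1,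
    tendsto_log_mul_inv.eventually_le_const hδ] with x hx hy hyt
  exact (h _ _ hy (inv_nonneg.2 hx) hyt).1

theorem tendsto_fN_exp (N : ℕ) : Tendsto (fun x => fN N (Real.exp x)) atTop atTop := by
  refine tendsto_atTop_mono' _ ?_ (Real.tendsto_exp_atTop.atTop_mul_const (by norm_num : (0:ℝ) < 1 / 2))
  filter_upwards [eventually_evalAt_vPoly N, eventually_ge_atTop 1] with x h hx
  rw [fN_exp]
  have := Real.exp_pos x
  have h1 : 1 * Real.exp x ≤ x * Real.exp x := by gcongr
  gcongr
  linarith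

theorem eventually_abs_eval_vCoeff_le {N : ℕ} (hN : 1 ≤ N) :
    ∀ᶠ y : ℝ in atTop, |(vCoeff (N + 1)).eval y| ≤ 3 / 2 * y ^ N := by
  set a := (vCoeff (N + 1)).coeff N
  have hr : (vCoeff (N + 1) - Polynomial.C a * Polynomial.X ^ N).natDegree ≤ N - 1 := by
    rw [Polynomial.natDegree_le_iff_coeff_eq_zero]
    intro m hm
    rw [Polynomial.coeff_sub, Polynomial.coeff_C_mul_X_pow]
    split_ifs with h
    · rw [h, sub_self]
    · rw [Polynomial.coeff_eq_zero_of_natDegree_lt, sub_zero]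
      have := natDegree_vCoeff_le_sub_one hN
      omega
  obtain ⟨C, hC0, hC⟩ := exists_abs_eval_le hr
  filter_upwards [eventually_ge_atTop 1, eventually_ge_atTop (2 * C)] with y h1 h2
  have h3 := hC y h1
  rw [Polynomial.eval_sub, Polynomial.eval_C_mul, Polynomial.eval_X_pow] at h3
  have h4 : C * y ^ (N - 1) ≤ 1 / 2 * y ^ N := by
    obtain ⟨m, rfl⟩ := Nat.exists_eq_add_of_le' hN
    rw [Nat.add_sub_cancel, pow_succ', ← mul_assoc]
    gcongr
    linarith
  have h5 : |a * y ^ N| ≤ y ^ N := by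
    rw [abs_mul, abs_of_nonneg (by positivity : 0 ≤ y ^ N)]
    exact mul_le_of_le_one_left (by positivity) (abs_coeff_vCoeff_le hN)
  have h6 := abs_sub_abs_le_abs_sub ((vCoeff (N + 1)).eval y) (a * y ^ N)
  linarith

/-- The size `u (log log u)^N / (log u)^(N+1)` of the error, at `u = eˣ`. -/
def errTerm (N : ℕ) (x : ℝ) : ℝ := Real.exp x * Real.log x ^ N * x⁻¹ ^ (N + 1)

theorem tendsto_errTerm (N : ℕ) : Tendsto (errTerm N) atTop atTop := by
  refine tendsto_atTop_mono' _ ?_ (Real.tendsto_exp_div_pow_atTop (N + 1))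
  filter_upwards [eventually_ge_atTop 0, Real.tendsto_log_atTop.eventually_ge_atTop 1] with x hx hy
  rw [errTerm, div_eq_mul_inv, inv_pow]
  have : 1 ≤ Real.log x ^ N := one_le_pow₀ hy
  gcongr
  exact le_mul_of_one_le_right (Real.exp_pos x).le this

/-- Differentiating `x^-(N+1)` loses a fraction `(N + 1) / x ≤ 1/2`; differentiating the power of
`log x` only helps. -/
theorem eventually_deriv_errTerm (N : ℕ) :
    ∀ᶠ x : ℝ in atTop, ∃ d, HasDerivAt (errTerm N) d x ∧ errTerm N x ≤ 2 * d := by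
  filter_upwards [eventually_gt_atTop 0, eventually_ge_atTop (2 * (N + 1 : ℝ)),
    Real.tendsto_log_atTop.eventually_ge_atTop 1] with x hx hxN hy
  refine ⟨_, ((Real.hasDerivAt_exp x).mul ((Real.hasDerivAt_log hx.ne').pow N)).mul
    ((hasDerivAt_inv hx.ne').pow (N + 1)), ?_⟩
  have h1 : (N + 1 : ℝ) * x⁻¹ ≤ 1 / 2 := by
    rw [← div_eq_mul_inv, div_le_iff₀ hx]; linarith
  simp only [errTerm, Pi.mul_apply, Pi.pow_apply, Nat.add_sub_cancel]
  have h2 : 0 ≤ Real.exp x * Real.log x ^ N * x⁻¹ ^ (N + 1) := by positivity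
  have h3 : 0 ≤ Real.exp x * (N * Real.log x ^ (N - 1) * x⁻¹) * x⁻¹ ^ (N + 1) := by positivity
  have h4 : Real.exp x * Real.log x ^ N * (((N + 1 : ℕ) : ℝ) * x⁻¹ ^ N * -(x ^ 2)⁻¹)
      = - (((N + 1 : ℝ) * x⁻¹) * (Real.exp x * Real.log x ^ N * x⁻¹ ^ (N + 1))) := by
    push_cast; ring
  rw [h4]
  nlinarith

theorem eventually_deriv_li_fN {N : ℕ} (hN : 1 ≤ N) :
    ∀ᶠ x : ℝ in atTop, ∃ d, HasDerivAt (fun x => li (fN N (Real.exp x)) - Real.exp x) d x ∧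
      |d| ≤ 2 * errTerm N x := by
  obtain ⟨C, δ, hC0, hδ, h⟩ := exists_abs_log_evalAt_sub_le N
  filter_upwards [eventually_gt_atTop 0, Real.tendsto_log_atTop.eventually_ge_atTop 1,
    tendsto_log_mul_inv.eventually_le_const hδ,
    tendsto_log_mul_inv.eventually_le_const (by positivity : 0 < 1 / (2 * (C + 1))),
    Real.tendsto_log_atTop.eventually (eventually_abs_eval_vCoeff_le hN),
    (tendsto_fN_exp N).eventually_gt_atTop 1] with x hx hy hyt1 hyt2 hP hf
  obtain ⟨hS, hlog⟩ := h _ _ hy (inv_nonneg.2 hx.le) hyt1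
  set y := Real.log x
  set t := x⁻¹
  set S := evalAt (vPoly N) y t
  have ht : 0 < t := inv_pos.2 hx
  have hlogf : Real.log (fN N (Real.exp x)) = y + x + Real.log S := by
    rw [fN_exp, Real.log_mul (by positivity) (by positivity), Real.log_mul hx.ne' (by positivity),
      Real.log_exp]
  have hlogS : -1 ≤ Real.log S := by
    have h1 := Real.log_le_log (by norm_num) hS
    rw [one_div, Real.log_inv] at h1
    linarith [Real.log_two_lt_d9]
  have hxf : x ≤ Real.log (fN N (Real.exp x)) := by rw [hlogf]; linarith
  have hf0 : 0 < Real.log (fN N (Real.exp x)) := hx.trans_le hxf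
  refine ⟨_, (HasDerivAt.comp (h₂ := li) (h := fun x => fN N (Real.exp x)) x (hasDerivAt_li hf)
    (hasDerivAt_fN_exp N hx)).sub (Real.hasDerivAt_exp x), ?_⟩
  have e : 1 / Real.log (fN N (Real.exp x)) * (Real.exp x * (x + Real.log x
      + evalAt (logPoly N) (Real.log x) x⁻¹ - (vCoeff (N + 1)).eval (Real.log x) * x⁻¹ ^ N))
      - Real.exp x = -(Real.exp x * ((Real.log S - evalAt (logPoly N) y t)
        + (vCoeff (N + 1)).eval y * t ^ N) / Real.log (fN N (Real.exp x))) := by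
    field_simp
    rw [hlogf]
    simp only [y, t]
    ring_nf
  rw [e, abs_neg, abs_div, abs_of_pos hf0, abs_mul, abs_of_pos (Real.exp_pos x)]
  -- The two parts of the numerator take `1/2` and `3/2` of the constant `2`.
  have h1 : C * (y * t) ^ (N + 1) ≤ 1 / 2 * (y * t) ^ N := by
    have : C * (y * t) ≤ 1 / 2 := by
      have h2 : C * (y * t) ≤ (C + 1) * (1 / (2 * (C + 1))) := by gcongr; linarith
      have h3 : (C + 1) * (1 / (2 * (C + 1))) = 1 / 2 := by field_simp
      linarith
    rw [pow_succ', ← mul_assoc]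
    gcongr
  have h2 : |(vCoeff (N + 1)).eval y * t ^ N| ≤ 3 / 2 * (y * t) ^ N := by
    rw [abs_mul, abs_of_nonneg (by positivity : 0 ≤ t ^ N), mul_pow, ← mul_assoc]
    gcongr
  have h3 : |(Real.log S - evalAt (logPoly N) y t) + (vCoeff (N + 1)).eval y * t ^ N|
      ≤ 2 * (y * t) ^ N := (abs_add_le _ _).trans (by linarith)
  calc Real.exp x * |(Real.log S - evalAt (logPoly N) y t) + (vCoeff (N + 1)).eval y * t ^ N|
        / Real.log (fN N (Real.exp x))
      ≤ Real.exp x * (2 * (y * t) ^ N) / x := by gcongr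
    _ = 2 * errTerm N x := by rw [errTerm]; simp only [t, y]; ring

theorem eventually_abs_li_fN_sub_le {N : ℕ} (hN : 1 ≤ N) :
    ∀ᶠ x : ℝ in atTop, |li (fN N (Real.exp x)) - Real.exp x| ≤ 13 * errTerm N x := by
  set F : ℝ → ℝ := fun x => li (fN N (Real.exp x)) - Real.exp x
  obtain ⟨a, ha⟩ := eventually_atTop.1
    ((eventually_deriv_li_fN hN).and (eventually_deriv_errTerm N))
  -- `4 errTerm' ≥ 2 errTerm ≥ |F'|`. Once `errTerm` exceeds the initial values at `a`, this yields
  -- `|F| ≤ 5 errTerm`, well within `13`.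
  have hmono : ∀ s : ℝ, |s| = 1 → MonotoneOn (fun x => 4 * errTerm N x + s * F x) (Set.Ici a) := by
    intro s hs
    have key : ∀ x, a ≤ x → ∃ d, HasDerivAt (fun x => 4 * errTerm N x + s * F x) d x ∧ 0 ≤ d := by
      intro x hx
      obtain ⟨⟨d, hd, hd'⟩, e, he, he'⟩ := ha x hx
      refine ⟨_, (he.const_mul 4).add (hd.const_mul s), ?_⟩
      have h1 : |s * d| ≤ 2 * errTerm N x := by rwa [abs_mul, hs, one_mul]
      linarith [neg_abs_le (s * d)]
    refine monotoneOn_of_deriv_nonneg (convex_Ici a) ?_ ?_ ?_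
    · intro x hx
      obtain ⟨d, hd, -⟩ := key x hx
      exact hd.continuousAt.continuousWithinAt
    · intro x hx
      obtain ⟨d, hd, -⟩ := key x (interior_subset hx)
      exact hd.differentiableAt.differentiableWithinAt
    · intro x hx
      obtain ⟨d, hd, h0⟩ := key x (interior_subset hx)
      rwa [hd.deriv]
  filter_upwards [eventually_ge_atTop a,
    (tendsto_errTerm N).eventually_ge_atTop (|F a| + 4 * |errTerm N a|)] with x hx hH
  have h1 := hmono 1 (by simp) Set.self_mem_Ici (Set.mem_Ici.2 hx) hx
  have h2 := hmono (-1) (by simp) Set.self_mem_Ici (Set.mem_Ici.2 hx) hx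
  simp only at h1 h2
  change |F x| ≤ _
  have := abs_le.1 (le_refl |F a|)
  have := abs_le.1 (le_refl |errTerm N a|)
  have := abs_nonneg (F a)
  have := abs_nonneg (errTerm N a)
  rw [abs_le]
  constructor <;> linarith

theorem isThreshold_iff {N : ℕ} {v : ℝ} :
    IsThreshold N v ↔ uN N ≤ v ∧ ∀ u : ℝ, v < u →
      |li (fN N u) - u| ≤ 13 * ((N + 1)! : ℝ) * errTerm N (Real.log u) := by
  unfold IsThreshold
  refine and_congr_right fun hv => forall₂_congr fun u hu => ?_
  have hx : Real.exp 2 < Real.log u := by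
    have h1 : Real.exp (xN N) < u := (show uN N ≤ v from hv).trans_lt hu
    have h2 := Real.log_lt_log (Real.exp_pos _) h1
    rw [Real.log_exp] at h2
    exact lt_of_le_of_lt ((le_max_right _ _).trans (le_max_right _ _)) h2
  have hu0 : 0 < u := (Real.exp_pos _).trans_le (show Real.exp (xN N) ≤ v from hv) |>.trans hu
  have hx0 : 0 < Real.log u := (Real.exp_pos 2).trans hx
  have hy0 : 0 < Real.log (Real.log u) := Real.log_pos ((Real.one_lt_exp_iff.2 two_pos).trans hx)
  have hE : u * Real.log (Real.log u) ^ N / Real.log u ^ (N + 1) = errTerm N (Real.log u) := by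
    rw [errTerm, Real.exp_log hu0, inv_pow, div_eq_mul_inv]
  have hpos : 0 < 13 * ((N + 1)! : ℝ) * errTerm N (Real.log u) := by
    rw [← hE]; positivity
  rw [hE]
  constructor
  · rintro ⟨θ, hθ, h⟩
    rw [h, mul_assoc θ, mul_assoc θ, abs_mul, abs_of_pos hpos]
    exact mul_le_of_le_one_left hpos.le hθ
  · intro h
    refine ⟨(li (fN N u) - u) / (13 * ((N + 1)! : ℝ) * errTerm N (Real.log u)), ?_, ?_⟩
    · rwa [abs_div, abs_of_pos hpos, div_le_one hpos]
    · rw [mul_assoc, mul_assoc, ← mul_assoc (13 : ℝ), div_mul_cancel₀ _ hpos.ne']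

theorem exists_isThreshold {N : ℕ} (hN : 1 ≤ N) : ∃ v : ℝ, uN N < v ∧ IsThreshold N v := by
  obtain ⟨a, ha⟩ := eventually_atTop.1 ((eventually_abs_li_fN_sub_le hN).and
    ((tendsto_errTerm N).eventually_ge_atTop 0))
  have hlt : uN N < Real.exp (max a (xN N) + 1) :=
    Real.exp_lt_exp.2 ((le_max_right _ _).trans_lt (lt_add_one _))
  refine ⟨_, hlt, isThreshold_iff.2 ⟨hlt.le, fun u hu => ?_⟩⟩
  have hu0 : 0 < u := (Real.exp_pos _).trans hu
  have hx : a ≤ Real.log u := by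
    rw [Real.le_log_iff_exp_le hu0]
    refine le_trans (Real.exp_le_exp.2 ?_) hu.le
    linarith [le_max_left a (xN N)]
  obtain ⟨h1, h2⟩ := ha _ hx
  rw [Real.exp_log hu0] at h1
  refine h1.trans ?_
  have : (1 : ℝ) ≤ (N + 1)! := by exact_mod_cast Nat.factorial_pos _
  gcongr
  linarith

/-! ### From `li (f_N u)` to `ali u` -/

/-- For `z > w`, the condition defining `cN` makes the sum of the `n! / z^n` less than `1`, in
particular its last term. Letting `z` decrease to `w` avoids showing that the infimum is attained.
-/
theorem factorial_le_pow {N : ℕ} (hN : 1 ≤ N) {w : ℝ} (hw0 : 0 < w) (hw : cN N ≤ w) :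
    (N ! : ℝ) ≤ w ^ N := by
  have hlim : Tendsto (fun x : ℝ => ∑ n ∈ Finset.Icc 1 N, (n ! : ℝ) / x ^ n) atTop (𝓝 0) := by
    rw [← Finset.sum_const_zero (s := Finset.Icc 1 N)]
    refine tendsto_finsetSum _ fun n hn => ?_
    have hn : n ≠ 0 := by have := (Finset.mem_Icc.1 hn).1; omega
    exact tendsto_const_nhds.div_atTop (tendsto_pow_atTop hn)
  obtain ⟨a, ha⟩ := eventually_atTop.1
    (hlim.eventually_le_const (by norm_num : (0 : ℝ) < 1 / 2))
  have hne : {c : ℝ | 0 < c ∧ ∀ x : ℝ, c ≤ x →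
      1 ≤ x * (1 - ∑ n ∈ Finset.Icc 1 N, (n ! : ℝ) / x ^ n)}.Nonempty := by
    refine ⟨max a 2, by positivity, fun x hx => ?_⟩
    have h1 := ha x ((le_max_left _ _).trans hx)
    have h2 : 2 ≤ x := (le_max_right _ _).trans hx
    nlinarith
  have key : ∀ z : ℝ, w < z → (N ! : ℝ) ≤ z ^ N := by
    intro z hz
    obtain ⟨c, ⟨-, hc⟩, hcz⟩ := exists_lt_of_csInf_lt hne (hw.trans_lt hz)
    have hz0 : 0 < z := hw0.trans hz
    have h1 := hc z hcz.le
    have h2 : (N ! : ℝ) / z ^ N ≤ ∑ n ∈ Finset.Icc 1 N, (n ! : ℝ) / z ^ n :=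
      Finset.single_le_sum (f := fun n => (n ! : ℝ) / z ^ n) (fun n _ => by positivity)
        (Finset.mem_Icc.2 ⟨hN, le_rfl⟩)
    have h3 : (N ! : ℝ) / z ^ N ≤ 1 := by
      by_contra! h
      nlinarith
    rwa [div_le_one (by positivity)] at h3
  have hcont : Tendsto (fun z : ℝ => z ^ N) (𝓝[>] w) (𝓝 (w ^ N)) :=
    ((continuous_pow N).tendsto w).mono_left nhdsWithin_le_nhds
  exact ge_of_tendsto hcont (eventually_mem_nhdsWithin.mono key)

theorem alphaN_le {N : ℕ} {x : ℝ} (hx : betaN N < x) : alphaN N ≤ x / Real.log x := by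
  have hα : Real.exp 1 ≤ alphaN N := le_max_left _ _
  have hα0 : 0 < alphaN N := (Real.exp_pos 1).trans_le hα
  have he : 1 ≤ Real.exp 1 := Real.one_le_exp zero_le_one
  have hne : {x : ℝ | Real.exp 1 ≤ x ∧ x / Real.log x = alphaN N}.Nonempty := by
    -- Intermediate values of `x / log x`: it is `e ≤ α` at `e`, and `e^(2α) / (2α) ≥ α` at
    -- `e^(2α)`.
    have hle : Real.exp 1 ≤ Real.exp (2 * alphaN N) := Real.exp_le_exp.2 (by linarith)
    have hc : ContinuousOn (fun x : ℝ => x / Real.log x)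
        (Set.Icc (Real.exp 1) (Real.exp (2 * alphaN N))) := by
      refine continuousOn_id.div (Real.continuousOn_log.mono fun x hx => ?_) fun x hx => ?_
      · exact ((Real.exp_pos 1).trans_le hx.1).ne'
      · exact (Real.log_pos ((Real.one_lt_exp_iff.2 one_pos).trans_le hx.1)).ne'
    obtain ⟨x, hx, hxα⟩ := intermediate_value_Icc hle hc (show alphaN N ∈ _ from by
      constructor
      · simpa using hα
      · rw [Real.log_exp, le_div_iff₀ (by positivity)]
        have := Real.quadratic_le_exp_of_nonneg (by positivity : 0 ≤ 2 * alphaN N)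
        nlinarith)
    exact ⟨x, hx.1, hxα⟩
  obtain ⟨s, ⟨hs, hsα⟩, hsx⟩ := exists_lt_of_csInf_lt hne hx
  have hlog : ∀ z : ℝ, Real.exp 1 ≤ z → 0 < Real.log z := fun z hz =>
    Real.log_pos ((Real.one_lt_exp_iff.2 one_pos).trans_le hz)
  have h := Real.log_div_self_antitoneOn (Set.mem_Ici.2 hs) (Set.mem_Ici.2 (hs.trans hsx.le)) hsx.le
  have h2 := inv_anti₀ (div_pos (hlog x (hs.trans hsx.le))
    ((Real.exp_pos 1).trans_le (hs.trans hsx.le))) h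
  simp only [inv_div] at h2
  rwa [hsα] at h2

theorem seven_lt_log {N : ℕ} {u : ℝ} (hu : uN N ≤ u) : 7 < Real.log u := by
  have h1 : xN N ≤ Real.log u := by
    rw [Real.le_log_iff_exp_le ((Real.exp_pos _).trans_le hu)]; exact hu
  have h2 : Real.exp 2 ≤ xN N := (le_max_right _ _).trans (le_max_right _ _)
  have h3 : Real.exp 2 = Real.exp 1 * Real.exp 1 := by rw [← Real.exp_add]; norm_num
  nlinarith [Real.exp_one_gt_d9]

theorem one_lt_of_uN_le {N : ℕ} {u : ℝ} (hu : uN N ≤ u) : 1 < u := by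
  have h := seven_lt_log hu
  exact (Real.log_pos_iff ((Real.exp_pos _).trans_le hu).le).1 (by linarith)

/-- The left side is `13 u · ((N + 1) / x) · N! (log x / x)^N`. Here `x ≥ 4(N + 1)/3` bounds the
second factor by `3/4` and `c_N ≤ x / log x` the third by `1`; finally `13 · 3/4 < 10`. -/
theorem errTerm_bound {N : ℕ} (hN : 1 ≤ N) {u : ℝ} (hu : uN N < u) :
    13 * ((N + 1)! : ℝ) * errTerm N (Real.log u) ≤ 10 * u := by
  have hx7 := seven_lt_log hu.le
  have hu0 : 0 < u := (Real.exp_pos _).trans hu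
  have hxN : xN N < Real.log u := (Real.lt_log_iff_exp_lt hu0).2 hu
  rw [errTerm, Real.exp_log hu0]
  set x := Real.log u
  have hx0 : 0 < x := by linarith
  have hy0 : 0 < Real.log x := Real.log_pos (by linarith)
  have hα := alphaN_le ((le_max_left _ _).trans_lt hxN)
  have hc : cN N ≤ x / Real.log x := ((le_max_left _ _).trans (le_max_right _ _)).trans hα
  have h1 := factorial_le_pow hN (by positivity) hc
  rw [div_pow, le_div_iff₀ (by positivity)] at h1
  have h2 : 4 * (N + 1 : ℝ) / 3 ≤ x := ((le_max_left _ _).trans (le_max_right _ _)).trans hxN.le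
  have h3 : (N + 1 : ℝ) * x⁻¹ ≤ 3 / 4 := by
    rw [← div_eq_mul_inv, div_le_iff₀ hx0]; linarith
  have h4 : (N ! : ℝ) * Real.log x ^ N * x⁻¹ ^ N ≤ 1 := by
    rw [inv_pow, ← div_eq_mul_inv, div_le_one (by positivity)]; exact h1
  have h5 : ((N + 1)! : ℝ) = (N + 1) * N ! := by rw [Nat.factorial_succ]; push_cast; ring
  calc 13 * ((N + 1)! : ℝ) * (u * Real.log x ^ N * x⁻¹ ^ (N + 1))
      = 13 * u * ((N + 1) * x⁻¹) * ((N ! : ℝ) * Real.log x ^ N * x⁻¹ ^ N) := by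
        rw [h5, pow_succ]; ring
    _ ≤ 13 * u * (3 / 4) * 1 := by gcongr
    _ ≤ 10 * u := by linarith

theorem continuousOn_fN (N : ℕ) : ContinuousOn (fN N) (Set.Ioi 1) := by
  intro u hu
  have hu : 1 < u := hu
  have h0 : u ≠ 0 := by linarith
  have hx : Real.log u ≠ 0 := (Real.log_pos hu).ne'
  have hx' : ∀ n : ℕ, Real.log u ^ n ≠ 0 := fun n => pow_ne_zero n hx
  have h1 : ContinuousAt Real.log u := Real.continuousAt_log h0
  have h2 : ContinuousAt (fun u => Real.log (Real.log u)) u := h1.log hx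
  refine ContinuousAt.continuousWithinAt ?_
  refine (h1.mul continuousAt_id).mul (continuousAt_const.add ?_)
  refine tendsto_finsetSum _ fun n _ => ?_
  exact ((P (n - 1)).continuous.continuousAt.comp h2).div (h1.pow n) (hx' n)

theorem tendsto_fN (N : ℕ) : Tendsto (fN N) atTop atTop := by
  refine ((tendsto_fN_exp N).comp Real.tendsto_log_atTop).congr' ?_
  filter_upwards [eventually_gt_atTop 0] with u hu
  simp [Real.exp_log hu]

/-- Otherwise, as `f_N` tends to infinity, it would later take values just above `1`, where `li`
tends to `-∞`, against `li (f_N(z)) ≥ z - 10 z`. -/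
theorem one_lt_fN {N : ℕ} (hN : 1 ≤ N) {v u : ℝ} (hv : IsThreshold N v) (hu : v < u) :
    1 < fN N u := by
  by_contra! hcon
  obtain ⟨hv, hb⟩ := isThreshold_iff.1 hv
  obtain ⟨U, hU2, hUu⟩ := (((tendsto_fN N).eventually_ge_atTop 2).and
    (eventually_ge_atTop u)).exists
  have hu1 : 1 < u := one_lt_of_uN_le (hv.trans hu.le)
  -- Chosen so that `li (1 + δ) ≤ log δ + 1 + δ < -9 U ≤ -9 z` for every `z ≤ U`.
  set δ := Real.exp (-(9 * U + 3)) with hδ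
  have hδ0 : 0 < δ := Real.exp_pos _
  have hδ1 : δ ≤ 1 := Real.exp_le_one_iff.2 (by linarith)
  obtain ⟨z, hz, hfz⟩ := intermediate_value_Icc hUu
    ((continuousOn_fN N).mono fun z hz => hu1.trans_le hz.1)
    (show 1 + δ ∈ _ from ⟨by linarith, by linarith⟩)
  have h1 := (abs_le.1 (hb z (hu.trans_le hz.1))).1
  have h2 := errTerm_bound hN (hv.trans_lt (hu.trans_le hz.1))
  have h3 := li_le (x := 1 + δ) (by linarith)
  rw [add_sub_cancel_left, hδ, Real.log_exp, ← hδ] at h3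
  rw [hfz] at h1
  linarith [hz.2]

theorem abs_ali_sub_fN_le {N : ℕ} (hN : 1 ≤ N) {v u : ℝ} (hv : IsThreshold N v) (hu : v < u) :
    |ali u - fN N u| ≤ 26 * ((N + 1)! : ℝ) * u * (Real.log (Real.log u) / Real.log u) ^ N := by
  have hf := one_lt_fN hN hv hu
  obtain ⟨hv, hb⟩ := isThreshold_iff.1 hv
  have hE := errTerm_bound hN (hv.trans_lt hu)
  have hb := hb u hu
  have hx := seven_lt_log (hv.trans hu.le)
  have hu1 := one_lt_of_uN_le (hv.trans hu.le)
  have hu0 : 0 < u := by linarith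
  have hu2 : 1 < u ^ 2 := one_lt_pow₀ hu1 two_ne_zero
  have hsq := lt_li_sq hx.le
  rw [Real.exp_log hu0] at hsq
  have hali : ali u ≤ u ^ 2 := by
    by_contra! h
    have := strictMonoOn_li hu2 (one_lt_ali u) h
    rw [li_ali] at this
    linarith
  have hfu : fN N u ≤ u ^ 2 := by
    by_contra! h
    have := strictMonoOn_li hu2 hf h
    linarith [(abs_le.1 hb).2]
  -- The intermediate point lies between `ali u` and `f_N(u)`, hence below `u ^ 2`, so its logarithm
  -- is at most `2 log u`.
  have hmvt : |ali u - fN N u| ≤ 2 * Real.log u * |li (fN N u) - u| := by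
    have key : ∀ a b : ℝ, 1 < a → b ≤ u ^ 2 → a < b →
        |b - a| ≤ 2 * Real.log u * |li b - li a| := by
      intro a b ha hb hab
      obtain ⟨ξ, hξ, h⟩ := li_sub_eq ha hab
      have h1 : Real.log ξ ≤ 2 * Real.log u := by
        have := Real.log_le_log (by linarith [hξ.1]) (hξ.2.le.trans hb)
        rwa [Real.log_pow] at this
      rw [h, abs_mul, abs_of_pos (Real.log_pos (ha.trans hξ.1))]
      gcongr
    rcases lt_trichotomy (ali u) (fN N u) with h | h | h
    · have := key _ _ (one_lt_ali u) hfu h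
      rwa [li_ali, abs_sub_comm] at this
    · rw [h, sub_self, abs_zero]; positivity
    · have := key _ _ hf hali h
      rwa [li_ali, abs_sub_comm u] at this
  calc |ali u - fN N u| ≤ 2 * Real.log u * |li (fN N u) - u| := hmvt
    _ ≤ 2 * Real.log u * (13 * ((N + 1)! : ℝ) * errTerm N (Real.log u)) := by gcongr
    _ = 26 * ((N + 1)! : ℝ) * u * (Real.log (Real.log u) / Real.log u) ^ N := by
      rw [errTerm, Real.exp_log hu0]
      have hinv : Real.log u * (Real.log u)⁻¹ = 1 := mul_inv_cancel₀ (by linarith)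
      rw [div_eq_mul_inv, mul_pow, pow_succ]
      linear_combination 26 * ((N + 1)! : ℝ) * u * Real.log (Real.log u) ^ N
        * (Real.log u)⁻¹ ^ N * hinv

/-- Every `z > v_N` lies beyond some admissible number. The value `u = v_N` follows by letting `z`
decrease to `u`, both sides being continuous. -/
theorem abs_ali_sub_fN_le_of_vN_le {N : ℕ} (hN : 1 ≤ N) {u : ℝ} (hu : vN N ≤ u) :
    |ali u - fN N u| ≤ 26 * ((N + 1)! : ℝ) * u * (Real.log (Real.log u) / Real.log u) ^ N := by
  obtain ⟨v₀, -, hv₀⟩ := exists_isThreshold hN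
  have hne : {v : ℝ | IsThreshold N v}.Nonempty := ⟨v₀, hv₀⟩
  have huN : uN N ≤ u := le_trans (le_csInf hne fun v hv => hv.1) hu
  have hgt : ∀ z : ℝ, u < z →
      |ali z - fN N z| ≤ 26 * ((N + 1)! : ℝ) * z * (Real.log (Real.log z) / Real.log z) ^ N := by
    intro z hz
    obtain ⟨v, hv, hvz⟩ := exists_lt_of_csInf_lt hne (hu.trans_lt hz)
    exact abs_ali_sub_fN_le hN hv hvz
  have hu1 := one_lt_of_uN_le huN
  have hx := seven_lt_log huN
  have hl : ContinuousAt Real.log u := Real.continuousAt_log (by linarith)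
  have hll : ContinuousAt (fun u => Real.log (Real.log u)) u := hl.log (by linarith)
  have c1 : ContinuousAt (fun u => |ali u - fN N u|) u :=
    (continuous_ali.continuousAt.sub ((continuousOn_fN N).continuousAt (Ioi_mem_nhds hu1))).abs
  have c2 : ContinuousAt (fun u : ℝ =>
      26 * ((N + 1)! : ℝ) * u * (Real.log (Real.log u) / Real.log u) ^ N) u :=
    (continuousAt_const.mul continuousAt_id).mul ((hll.div hl (by linarith)).pow N)
  exact le_of_tendsto_of_tendsto (b := 𝓝[>] u) (c1.tendsto.mono_left nhdsWithin_le_nhds)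
    (c2.tendsto.mono_left nhdsWithin_le_nhds) (eventually_mem_nhdsWithin.mono hgt)

end AliExpansion

end

theorem mainTheorem2 (N : ℕ) (hN : 1 ≤ N) :
    (∃ v : ℝ, AliExpansion.uN N < v ∧ AliExpansion.IsThreshold N v) ∧
    ∀ u : ℝ, AliExpansion.vN N ≤ u → ∃ θ : ℝ, |θ| ≤ 1 ∧
      AliExpansion.ali u = AliExpansion.fN N u
        + 26 * θ * ((N + 1)! : ℝ) * u * (Real.log (Real.log u) / Real.log u) ^ N := by
  refine ⟨AliExpansion.exists_isThreshold hN, fun u hu => ?_⟩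
  have h := AliExpansion.abs_ali_sub_fN_le_of_vN_le hN hu
  set B := 26 * ((N + 1)! : ℝ) * u * (Real.log (Real.log u) / Real.log u) ^ N with hB
  have e : ∀ θ : ℝ, 26 * θ * ((N + 1)! : ℝ) * u * (Real.log (Real.log u) / Real.log u) ^ N
      = θ * B := fun θ => by rw [hB]; ring
  simp only [e]
  rcases (((abs_nonneg _).trans h).eq_or_lt) with h0 | h0
  · refine ⟨0, by simp, ?_⟩
    rw [← h0, abs_nonpos_iff] at h
    linarith
  · refine ⟨(AliExpansion.ali u - AliExpansion.fN N u) / B, ?_, ?_⟩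
    · rwa [abs_div, abs_of_pos h0, div_le_one h0]
    · rw [div_mul_cancel₀ _ h0.ne']; ring
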